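/- Let $\mathbb{P}$ be the space of complex polynomials. A Jacobi-type pencil is a tuple $\Theta=(J_3,J_5,\alpha,\beta)$, where $\alpha>0$, $\beta\in\mathbb{R}$, $J_3$ is a semi-infinite real symmetric tridiagonal matrix with positive subdiagonal (a Jacobi matrix), and $J_5$ is a semi-infinite real symmetric five-diagonal matrix with positive entries on the second subdiagonal. Its associated polynomials $(p_n)_{n\ge 0}$ are defined by $p_0(\lambda)=1$, $p_1(\lambda)=\alpha\lambda+\beta$ and $(J_5-\lambda J_3)(p_0(\lambda),p_1(\lambda),\dots)^{T}=0$. A sesquilinear functional $S$ on $\mathbb{P}$ (linear in the first, conjugate-linear in the second argument) is the spectral function of $\Theta$ if $S(p_n,p_m)=\delta_{n,m}$ for all $n,m\ge 0$. Let $S$ be a sesquilinear functional on $\mathbb{P}$ with $\overline{S(u,v)}=S(v,u)$ and $S(u,u)\ge 0$ for all $u,v\in\mathbb{P}$. Then $S$ is the spectral function of some Jacobi-type pencil if and only if $$S(u,v)=\int_{\mathbb{R}} u(\mathcal{A})(1)\,\overline{v(\mathcal{A})(1)}\,d\sigma,\qquad u,v\in\mathbb{P}, \qquad (*)$$ for some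 Borel probability measure $\sigma$ on $\mathbb{R}$ with all power moments finite and $\int_{\mathbb{R}}|g|^2\,d\sigma>0$ for every non-zero $g\in\mathbb{P}$, and some linear operator $\mathcal{A}$ in $L^2_\sigma$ such that (i) the domain of $\mathcal{A}$ is the set $\mathcal{P}$ of classes of polynomials in $L^2_\sigma$; (ii) for each $k\ge 0$, $\mathcal{A}x^k=\xi_{k,k+1}x^{k+1}+\sum_{j=0}^{k}\xi_{k,j}x^j$ with $\xi_{k,k+1}>0$ and $\xi_{k,j}\in\mathbb{R}$ for $0\le j\le k$; (iii) $\mathcal{A}\Lambda_0$ is symmetric, i.e. $(\mathcal{A}\Lambda_0 f,g)_{L^2_\sigma}=(f,\mathcal{A}\Lambda_0 g)_{L^2_\sigma}$ for $f,g\in\mathcal{P}$, where $\Lambda_0$ is multiplication by the independent variable on $\mathcal{P}$. Moreover, whenever $\sigma$ and $\mathcal{A}$ are as above and $(*)$ holds, $S$ is the spectral function of the following Jacobi-type pencil $(J_3,J_5,\alpha,\beta)$. Let $(r_n)_{n\ge 0}$ be the orthonormal polynomials of $\sigma$ with positive leading coefficients and $s_k=\int x^k\,d\sigma$. Then $J_3$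 is the Jacobi matrix of $\sigma$, i.e. $J_3(r_0(\lambda),r_1(\lambda),\dots)^{T}=\lambda(r_0(\lambda),r_1(\lambda),\dots)^{T}$; the entries of $J_5$ are $(J_5)_{m,n}=(\mathcal{A}\Lambda_0 r_n,r_m)_{L^2_\sigma}$, $m,n\ge 0$; and $$\alpha=\frac{1}{\xi_{0,1}\sqrt{s_2-s_1^2}},\qquad \beta=-\frac{\xi_{0,1}s_1+\xi_{0,0}}{\xi_{0,1}\sqrt{s_2-s_1^2}}.$$ -/

import Mathlib

noncomputable section

open MeasureTheory Polynomial ComplexConjugate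

namespace JacobiPencil

/-- A Jacobi-type pencil `(J₃, J₅, α, β)`: `J₃` is a semi-infinite Jacobi matrix, `J₅` is a
semi-infinite real symmetric five-diagonal matrix with positive second subdiagonal,
`α > 0` and `β` is real. -/
structure Pencil where
  J₃ : Matrix ℕ ℕ ℝ
  J₅ : Matrix ℕ ℕ ℝ
  α : ℝ
  β : ℝ
  J₃_symm : J₃.IsSymm
  J₃_tridiagonal : ∀ m n, n + 1 < m → J₃ m n = 0
  J₃_pos : ∀ n, 0 < J₃ (n + 1) n
  J₅_symm : J₅.IsSymm
  J₅_fiveDiagonal : ∀ m n, n + 2 < m → J₅ m n = 0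
  J₅_pos : ∀ n, 0 < J₅ (n + 2) n
  α_pos : 0 < α

/-- `p` is the system of polynomials associated to the pencil:
`p₀ = 1`, `p₁ = α λ + β` and `(J₅ - λ J₃) p⃗(λ) = 0`.
The entries of row `n` of `J₃` and `J₅` vanish beyond column `n + 2`, so that the product of the
row with the infinite column is the sum below. -/
structure Pencil.IsAssociated (Θ : Pencil) (p : ℕ → ℂ[X]) : Prop where
  zero : p 0 = 1
  one : p 1 = C (Θ.α : ℂ) * X + C (Θ.β : ℂ)
  row : ∀ n, ∑ m ∈ Finset.range (n + 3),
    (C (Θ.J₅ n m : ℂ) - X * C (Θ.J₃ n m : ℂ)) * p m = 0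

/-- The sesquilinear functional `S` (linear in the first argument, conjugate-linear in the second)
is the spectral function of the pencil `Θ`: `S(pₙ, pₘ) = δₙₘ` for the associated polynomials. -/
def Pencil.IsSpectralFunction (Θ : Pencil) (S : ℂ[X] →ₗ[ℂ] ℂ[X] →ₗ⋆[ℂ] ℂ) : Prop :=
  ∃ p : ℕ → ℂ[X], Θ.IsAssociated p ∧ ∀ n m, S (p n) (p m) = if n = m then 1 else 0

/-- A probability measure on the Borel sets of `ℝ` with all power moments finite, such that
`∫ |g|² dσ > 0` for every non-zero complex polynomial `g`. -/
structure Admissible (σ : Measure ℝ) : Prop where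
  prob : IsProbabilityMeasure σ
  moments : ∀ n : ℕ, Integrable (fun x : ℝ => x ^ n) σ
  pos : ∀ g : ℂ[X], g ≠ 0 → 0 < ∫ x : ℝ, ‖g.eval (x : ℂ)‖ ^ 2 ∂σ

variable {σ : Measure ℝ}

theorem Admissible.memLp (hσ : Admissible σ) (p : ℂ[X]) :
    MemLp (fun x : ℝ => p.eval (x : ℂ)) 2 σ := by
  induction p using Polynomial.induction_on' with
  | add p q hp hq =>
    refine (hp.add hq).ae_eq (Filter.Eventually.of_forall fun x => ?_)
    simp
  | monomial n a =>
    simp only [eval_monomial]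
    refine MemLp.const_mul ?_ a
    rw [memLp_two_iff_integrable_sq_norm (by fun_prop)]
    refine (hσ.moments (2 * n)).congr (Filter.Eventually.of_forall fun x => ?_)
    simp only [norm_pow, Complex.norm_real, Real.norm_eq_abs]
    rw [← pow_mul, mul_comm n 2, pow_mul, pow_mul, sq_abs]

/-- The class `[p]` in `L²_σ` of a complex polynomial `p`. -/
def Admissible.cls (hσ : Admissible σ) : ℂ[X] →ₗ[ℂ] Lp ℂ 2 σ where
  toFun p := (hσ.memLp p).toLp _
  map_add' p q := by
    rw [← MemLp.toLp_add]
    exact MemLp.toLp_congr _ _ (Filter.Eventually.of_forall fun x => by simp)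
  map_smul' c p := by
    rw [RingHom.id_apply, ← MemLp.toLp_const_smul]
    exact MemLp.toLp_congr _ _ (Filter.Eventually.of_forall fun x => by simp)

/-- The subspace `𝒫` of all classes of polynomials in `L²_σ`. -/
abbrev Admissible.polys (hσ : Admissible σ) : Submodule ℂ (Lp ℂ 2 σ) :=
  LinearMap.range hσ.cls

/-- The class of a polynomial, as an element of `𝒫`. -/
abbrev Admissible.toPolys (hσ : Admissible σ) (p : ℂ[X]) : hσ.polys :=
  hσ.cls.rangeRestrict p

theorem Admissible.mul_ae (hσ : Admissible σ) (p : ℂ[X]) :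
    (fun x : ℝ => (x : ℂ) * (hσ.cls p : ℝ → ℂ) x) =ᵐ[σ] fun x : ℝ => (X * p).eval (x : ℂ) := by
  have h : (hσ.cls p : ℝ → ℂ) =ᵐ[σ] fun x : ℝ => p.eval (x : ℂ) := (hσ.memLp p).coeFn_toLp
  filter_upwards [h] with x hx
  rw [hx, eval_mul, eval_X]

theorem Admissible.mul_memLp (hσ : Admissible σ) (f : hσ.polys) :
    MemLp (fun x : ℝ => (x : ℂ) * ((f : Lp ℂ 2 σ) : ℝ → ℂ) x) 2 σ := by
  obtain ⟨_, p, rfl⟩ := f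
  exact (hσ.memLp (X * p)).ae_eq (hσ.mul_ae p).symm

/-- The operator `Λ₀` of multiplication by the independent variable, restricted to `𝒫`. -/
def Admissible.mulX (hσ : Admissible σ) : Module.End ℂ hσ.polys where
  toFun f := ⟨(hσ.mul_memLp f).toLp _, by
    obtain ⟨_, p, rfl⟩ := f
    exact ⟨X * p, MemLp.toLp_congr (hσ.memLp (X * p)) _ (hσ.mul_ae p).symm⟩⟩
  map_add' f g := by
    apply Subtype.ext
    change (hσ.mul_memLp (f + g)).toLp _ = (hσ.mul_memLp f).toLp _ + (hσ.mul_memLp g).toLp _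
    rw [← MemLp.toLp_add]
    refine MemLp.toLp_congr _ _ ?_
    filter_upwards [Lp.coeFn_add (f : Lp ℂ 2 σ) (g : Lp ℂ 2 σ)] with x hx
    simp only [Submodule.coe_add, Pi.add_apply] at hx ⊢
    rw [hx, mul_add]
  map_smul' c f := by
    apply Subtype.ext
    change (hσ.mul_memLp (c • f)).toLp _ = c • (hσ.mul_memLp f).toLp _
    rw [← MemLp.toLp_const_smul]
    refine MemLp.toLp_congr _ _ ?_
    filter_upwards [Lp.coeFn_smul c (f : Lp ℂ 2 σ)] with x hx
    simp only [Submodule.coe_smul, Pi.smul_apply, smul_eq_mul] at hx ⊢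
    rw [hx, mul_left_comm]

/-- For each `k`, `𝒜 x^k = ξ_{k,k+1} x^{k+1} + ∑_{j ≤ k} ξ_{k,j} x^j` with `ξ_{k,k+1} > 0` and all
`ξ_{k,j}` real. -/
def IsExpansion (hσ : Admissible σ) (𝒜 : Module.End ℂ hσ.polys) (ξ : ℕ → ℕ → ℝ) : Prop :=
  ∀ k, 0 < ξ k (k + 1) ∧
    𝒜 (hσ.toPolys (X ^ k)) = hσ.toPolys (C (ξ k (k + 1) : ℂ) * X ^ (k + 1) +
      ∑ j ∈ Finset.range (k + 1), C (ξ k j : ℂ) * X ^ j)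

/-- The conditions on the operator `𝒜`. A linear operator in `L²_σ` with domain `𝒫` that satisfies
`expansion` maps `𝒫` into `𝒫`; it is therefore given as an endomorphism of `𝒫`. -/
structure IsModelOperator (hσ : Admissible σ) (𝒜 : Module.End ℂ hσ.polys) : Prop where
  expansion : ∃ ξ : ℕ → ℕ → ℝ, IsExpansion hσ 𝒜 ξ
  symmetric : (𝒜 ∘ₗ hσ.mulX).IsSymmetric

/-- `S(u, v) = ∫ u(𝒜)(1) conj(v(𝒜)(1)) dσ` for all complex polynomials `u`, `v`. -/
def Represents (hσ : Admissible σ) (𝒜 : Module.End ℂ hσ.polys)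
    (S : ℂ[X] →ₗ[ℂ] ℂ[X] →ₗ⋆[ℂ] ℂ) : Prop :=
  ∀ u v : ℂ[X], S u v =
    ∫ x : ℝ, ((aeval 𝒜 u (hσ.toPolys 1) : Lp ℂ 2 σ) : ℝ → ℂ) x *
      conj (((aeval 𝒜 v (hσ.toPolys 1) : Lp ℂ 2 σ) : ℝ → ℂ) x) ∂σ

/-- `r` is the system of orthonormal polynomials of `σ` with positive leading coefficients. -/
structure IsOrthonormalSystem (σ : Measure ℝ) (r : ℕ → ℝ[X]) : Prop where
  natDegree_eq : ∀ n, (r n).natDegree = n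
  leadingCoeff_pos : ∀ n, 0 < (r n).leadingCoeff
  orthonormal : ∀ n m, ∫ x, (r n).eval x * (r m).eval x ∂σ = if n = m then 1 else 0

/-- `Θ` is the pencil reconstructed from `σ` and `𝒜`: with the orthonormal polynomials `r` of `σ`,
`J₃` is the Jacobi matrix of their recurrence coefficients (`J₃ r⃗(λ) = λ r⃗(λ)`),
`J₅` is the matrix `(𝒜 Λ₀ rₙ, rₘ)` (the scalar product, linear in its first argument,
is `inner ℂ rₘ (𝒜 Λ₀ rₙ)`), and `α`, `β` are computed from
`𝒜 1 = ξ_{0,1} x + ξ_{0,0}` and the first two moments `s₁`, `s₂` of `σ`. -/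
structure IsReconstructed (hσ : Admissible σ) (𝒜 : Module.End ℂ hσ.polys) (ξ : ℕ → ℕ → ℝ)
    (r : ℕ → ℝ[X]) (Θ : Pencil) : Prop where
  J₃_eq : ∀ n, ∑ m ∈ Finset.range (n + 2), C (Θ.J₃ n m) * r m = X * r n
  J₅_eq : ∀ m n, (Θ.J₅ m n : ℂ) =
    inner ℂ (hσ.toPolys ((r m).map Complex.ofRealHom))
      (𝒜 (hσ.mulX (hσ.toPolys ((r n).map Complex.ofRealHom))))
  α_eq : Θ.α = 1 / (ξ 0 1 * √((∫ x, x ^ 2 ∂σ) - (∫ x, x ∂σ) ^ 2))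
  β_eq : Θ.β = -(ξ 0 1 * (∫ x, x ∂σ) + ξ 0 0) /
    (ξ 0 1 * √((∫ x, x ^ 2 ∂σ) - (∫ x, x ∂σ) ^ 2))

end JacobiPencil

end

/-!
The associated polynomials of a pencil and the orthonormal polynomials of its matrix `J₃` are both
triangular, so `p n ↦ r n` extends to a linear isomorphism from `ℂ[X]` onto `𝒫`, and `𝒜` is
multiplication by `λ` transported along it. In the basis `r` the operator `Λ₀` has the matrix `J₃`,
and the recurrence `J₅ p = λ J₃ p` becomes the statement that `𝒜 Λ₀` has the matrix `J₅`; hence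
`𝒜 Λ₀` is symmetric exactly because `J₅` is. The measure is provided by Favard's theorem, which
follows from Haviland's extension of a positive functional (M. Riesz) and its representation on
continuous functions (Riesz–Markov–Kakutani).
-/

noncomputable section

open MeasureTheory Polynomial ComplexConjugate

namespace JacobiPencil

/-! ### Positive functionals on polynomials -/

section Hamburger

open Filter Topology CompactlySupported

theorem eval_nonneg_of_mul {d q : ℝ[X]} (hd0 : d ≠ 0) (hd : ∀ x, 0 ≤ d.eval x)
    (hdq : ∀ x, 0 ≤ (d * q).eval x) (x : ℝ) : 0 ≤ q.eval x := by
  have hdense : Dense {y : ℝ | d.IsRoot y}ᶜ := (finite_setOfPred_isRoot hd0).countable.dense_compl ℝ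
  have hclosed : IsClosed {y : ℝ | 0 ≤ q.eval y} := isClosed_le continuous_const q.continuous
  refine hclosed.closure_subset_iff.2 (fun y hy => ?_) (hdense x)
  have hy' := hdq y
  rw [eval_mul] at hy'
  exact nonneg_of_mul_nonneg_right hy' ((hd y).lt_of_ne' hy)

theorem sq_dvd_of_isRoot_of_eval_nonneg {p : ℝ[X]} (hp : ∀ x, 0 ≤ p.eval x) {a : ℝ}
    (ha : p.IsRoot a) : (X - C a) ^ 2 ∣ p := by
  rcases eq_or_ne p 0 with rfl | hp0
  · exact dvd_zero _
  have hmin : IsLocalMin (fun x => p.eval x) a :=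
    Eventually.of_forall fun x => ha.eq_zero.trans_le (hp x)
  have hder : p.derivative.IsRoot a := by simpa using hmin.deriv_eq_zero
  rw [← le_rootMultiplicity_iff hp0]
  exact (one_lt_rootMultiplicity_iff_isRoot hp0).2 ⟨ha, hder⟩

theorem exists_sq_add_sq_dvd_of_eval_nonneg {p : ℝ[X]} (hp : ∀ x, 0 ≤ p.eval x)
    (hdeg : p.natDegree ≠ 0) : ∃ a b : ℝ, (X - C a) ^ 2 + C b ^ 2 ∣ p := by
  obtain ⟨z, hz⟩ : ∃ z : ℂ, aeval z p = 0 :=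
    IsAlgClosed.exists_aeval_eq_zero _ _ fun h => hdeg (natDegree_eq_of_degree_eq_some h)
  by_cases him : z.im = 0
  · have hroot : p.IsRoot z.re := by
      rw [← Complex.conj_eq_iff_im, Complex.conj_eq_iff_re] at him
      rw [← him, ← Complex.coe_algebraMap, aeval_algebraMap_apply] at hz
      simpa using hz
    exact ⟨z.re, 0, by simpa using sq_dvd_of_isRoot_of_eval_nonneg hp hroot⟩
  · refine ⟨z.re, z.im, ?_⟩
    convert p.quadratic_dvd_of_aeval_eq_zero_im_ne_zero hz him using 1
    rw [← Complex.normSq_eq_norm_sq, Complex.normSq_apply]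
    simp only [C_mul, C_add, C_ofNat]
    ring

theorem exists_eq_sq_add_sq_of_eval_nonneg (p : ℝ[X]) (hp : ∀ x, 0 ≤ p.eval x) :
    ∃ a b : ℝ[X], p = a ^ 2 + b ^ 2 := by
  induction hn : p.natDegree using Nat.strong_induction_on generalizing p with
  | _ n ih =>
  subst hn
  by_cases hdeg : p.natDegree = 0
  · obtain ⟨c, rfl⟩ := natDegree_eq_zero.1 hdeg
    have hc : 0 ≤ c := by simpa using hp 0
    exact ⟨C √c, 0, by rw [← C_pow, Real.sq_sqrt hc]; simp⟩
  obtain ⟨a, b, q, hq⟩ := exists_sq_add_sq_dvd_of_eval_nonneg hp hdeg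
  have hd2 : ((X - C a) ^ 2 + C b ^ 2 : ℝ[X]).natDegree = 2 := by
    rw [← C_pow, natDegree_add_C]
    simp
  have hd0 : ((X - C a) ^ 2 + C b ^ 2 : ℝ[X]) ≠ 0 := ne_zero_of_natDegree_gt (n := 0) (by omega)
  have hq0 : q ≠ 0 := by
    rintro rfl
    simp [hq] at hdeg
  have hqnonneg : ∀ x, 0 ≤ q.eval x :=
    eval_nonneg_of_mul hd0 (fun x => by simp only [eval_add, eval_pow]; positivity) (hq ▸ hp)
  obtain ⟨u, v, rfl⟩ := ih q.natDegree (by rw [hq, natDegree_mul hd0 hq0]; omega) q hqnonneg rfl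
  exact ⟨_, _, hq.trans sq_add_sq_mul_sq_add_sq⟩

/-- The space of continuous functions on the line dominated by a polynomial, on which the positive
extension of a moment functional lives. -/
def polyBounded : Submodule ℝ C(ℝ, ℝ) where
  carrier := {f | ∃ p : ℝ[X], ∀ x, |f x| ≤ p.eval x}
  zero_mem' := ⟨0, by simp⟩
  add_mem' := by
    rintro f g ⟨p, hp⟩ ⟨q, hq⟩
    refine ⟨p + q, fun x => ?_⟩
    rw [eval_add]
    exact (abs_add_le _ _).trans (add_le_add (hp x) (hq x))
  smul_mem' := by
    rintro c f ⟨p, hp⟩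
    refine ⟨C |c| * p, fun x => ?_⟩
    simp only [ContinuousMap.smul_apply, smul_eq_mul, abs_mul, eval_mul, eval_C]
    exact mul_le_mul_of_nonneg_left (hp x) (abs_nonneg c)

theorem toContinuousMap_mem_polyBounded (p : ℝ[X]) : p.toContinuousMap ∈ polyBounded := by
  refine ⟨p ^ 2 + 1, fun x => abs_le.2 ?_⟩
  simp only [toContinuousMap_apply, eval_add, eval_pow, eval_one]
  constructor <;> nlinarith [sq_nonneg (p.eval x - 1), sq_nonneg (p.eval x + 1)]

theorem coe_mem_polyBounded (f : C_c(ℝ, ℝ)) : (f : C(ℝ, ℝ)) ∈ polyBounded := by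
  obtain ⟨c, hc⟩ := f.hasCompactSupport.exists_bound_of_continuous f.continuous
  exact ⟨C c, fun x => by simpa using hc x⟩

/-- Polynomial functions as polynomially bounded functions. -/
def polyFun : ℝ[X] →ₗ[ℝ] polyBounded :=
  (toContinuousMapAlgHom : ℝ[X] →ₐ[ℝ] C(ℝ, ℝ)).toLinearMap.codRestrict _
    toContinuousMap_mem_polyBounded

theorem polyFun_injective : Function.Injective polyFun := fun _ _ h =>
  Polynomial.funext fun x => congrArg (fun f : polyBounded => (f : C(ℝ, ℝ)) x) h

/-- Compactly supported functions as polynomially bounded functions. -/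
def compactlySupportedIncl : C_c(ℝ, ℝ) →ₗ[ℝ] polyBounded where
  toFun f := ⟨f, coe_mem_polyBounded f⟩
  map_add' _ _ := rfl
  map_smul' _ _ := rfl

theorem exists_nonneg_extension {L : ℝ[X] →ₗ[ℝ] ℝ} (hL : ∀ p, (∀ x, 0 ≤ p.eval x) → 0 ≤ L p) :
    ∃ G : polyBounded →ₗ[ℝ] ℝ, (∀ p, G (polyFun p) = L p) ∧ ∀ f, 0 ≤ f → 0 ≤ G f := by
  let e := LinearEquiv.ofInjective polyFun polyFun_injective
  let F : polyBounded →ₗ.[ℝ] ℝ := ⟨LinearMap.range polyFun, L ∘ₗ e.symm.toLinearMap⟩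
  have hF : ∀ p, F (e p) = L p := fun p => congrArg L (e.symm_apply_apply p)
  obtain ⟨G, hG, hpos⟩ := riesz_extension
    ((PointedCone.positive ℝ C(ℝ, ℝ)).comap polyBounded.subtype) F
    (fun f hf => by
      obtain ⟨p, rfl⟩ := e.surjective f
      rw [hF]
      exact hL p hf)
    (fun ⟨_, p, hp⟩ => ⟨e p, fun x => neg_le_iff_add_nonneg'.1 (neg_le_of_abs_le (hp x))⟩)
  exact ⟨G, fun p => (hG (e p)).trans (hF p), hpos⟩

/-- The trapezoidal cutoff function: `1` on `[-n, n]` and `0` outside `[-(n+1), n+1]`. -/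
def cutoff (n : ℕ) (x : ℝ) : ℝ := max 0 (min 1 (n + 1 - |x|))

theorem cutoff_nonneg (n : ℕ) (x : ℝ) : 0 ≤ cutoff n x := le_max_left _ _

theorem cutoff_le_one (n : ℕ) (x : ℝ) : cutoff n x ≤ 1 := max_le zero_le_one (min_le_left _ _)

theorem cutoff_eq_one {n : ℕ} {x : ℝ} (h : |x| ≤ n) : cutoff n x = 1 := by
  unfold cutoff
  rw [min_eq_left (by linarith), max_eq_right zero_le_one]

theorem monotone_cutoff (x : ℝ) : Monotone fun n => cutoff n x := fun m n h =>
  max_le_max_left _ (min_le_min_left _ (by gcongr))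

theorem continuous_cutoff (n : ℕ) : Continuous (cutoff n) := by
  unfold cutoff
  fun_prop

theorem hasCompactSupport_cutoff (n : ℕ) : HasCompactSupport (cutoff n) := by
  refine HasCompactSupport.intro (isCompact_Icc (a := -(n + 1 : ℝ)) (b := n + 1)) fun x hx => ?_
  have hx' : (n + 1 : ℝ) < |x| := not_le.1 fun h => hx (abs_le.1 h)
  exact max_eq_left ((min_le_right _ _).trans (by linarith))

theorem one_sub_cutoff_le {n : ℕ} (hn : 0 < n) (x : ℝ) : 1 - cutoff n x ≤ x ^ 2 / n ^ 2 := by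
  have hn' : (0 : ℝ) < n := Nat.cast_pos.2 hn
  rcases le_total |x| n with hx | hx
  · rw [cutoff_eq_one hx, sub_self]
    positivity
  · have h1 : 1 ≤ x ^ 2 / (n : ℝ) ^ 2 := by
      rw [one_le_div (by positivity), ← sq_abs x]
      exact pow_le_pow_left₀ hn'.le hx 2
    linarith [cutoff_nonneg n x]

/-- The product of a polynomial with a cutoff function; it approximates the polynomial by compactly
supported functions. -/
def cutPoly (p : ℝ[X]) (n : ℕ) : C_c(ℝ, ℝ) :=
  ⟨⟨fun x => p.eval x * cutoff n x, p.continuous.mul (continuous_cutoff n)⟩,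
    (hasCompactSupport_cutoff n).mul_left⟩

theorem cutPoly_apply (p : ℝ[X]) (n : ℕ) (x : ℝ) : cutPoly p n x = p.eval x * cutoff n x := rfl

theorem tendsto_cutPoly (p : ℝ[X]) (x : ℝ) :
    Tendsto (fun n => cutPoly p n x) atTop (𝓝 (p.eval x)) := by
  obtain ⟨N, hN⟩ := exists_nat_ge |x|
  refine tendsto_const_nhds.congr' ?_
  filter_upwards [eventually_ge_atTop N] with n hn
  rw [cutPoly_apply, cutoff_eq_one (hN.trans (Nat.cast_le.2 hn)), mul_one]

theorem tendsto_map_cutPoly {G : polyBounded →ₗ[ℝ] ℝ} (hG : ∀ f, 0 ≤ f → 0 ≤ G f) {p : ℝ[X]}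
    (hp : ∀ x, 0 ≤ p.eval x) :
    Tendsto (fun n => G (compactlySupportedIncl (cutPoly p n))) atTop (𝓝 (G (polyFun p))) := by
  have hmono : ∀ f g : polyBounded, f ≤ g → G f ≤ G g := fun f g h => by
    simpa only [map_sub, sub_nonneg] using hG (g - f) (sub_nonneg.2 h)
  have hupper (n : ℕ) : G (compactlySupportedIncl (cutPoly p n)) ≤ G (polyFun p) :=
    hmono _ _ fun x => mul_le_of_le_one_right (hp x) (cutoff_le_one n x)
  have hlower (n : ℕ) (hn : 0 < n) :
      G (polyFun p) - G (polyFun (X ^ 2 * p)) / n ^ 2 ≤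
        G (compactlySupportedIncl (cutPoly p n)) := by
    rw [div_eq_inv_mul, ← smul_eq_mul, ← map_smul, ← map_sub]
    refine hmono _ _ fun x => ?_
    change p.eval x - ((n : ℝ) ^ 2)⁻¹ * (X ^ 2 * p).eval x ≤ p.eval x * cutoff n x
    have := mul_le_mul_of_nonneg_left (one_sub_cutoff_le hn x) (hp x)
    rw [div_eq_mul_inv] at this
    rw [eval_mul, eval_pow, eval_X]
    linarith
  have hlim : Tendsto (fun n : ℕ => G (polyFun p) - G (polyFun (X ^ 2 * p)) / (n : ℝ) ^ 2) atTop
      (𝓝 (G (polyFun p))) := by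
    simpa using tendsto_const_nhds.sub (tendsto_const_nhds.div_atTop
      ((tendsto_pow_atTop (α := ℝ) two_ne_zero).comp tendsto_natCast_atTop_atTop))
  exact tendsto_of_tendsto_of_tendsto_of_le_of_le' hlim tendsto_const_nhds
    ((eventually_gt_atTop 0).mono hlower) (.of_forall hupper)

theorem exists_measure_lintegral_eq {G : polyBounded →ₗ[ℝ] ℝ} (hG : ∀ f, 0 ≤ f → 0 ≤ G f) :
    ∃ σ : Measure ℝ, ∀ p : ℝ[X], (∀ x, 0 ≤ p.eval x) →
      ∫⁻ x, ENNReal.ofReal (p.eval x) ∂σ = ENNReal.ofReal (G (polyFun p)) := by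
  let Λ : C_c(ℝ, ℝ) →ₚ[ℝ] ℝ :=
    PositiveLinearMap.mk₀ (G ∘ₗ compactlySupportedIncl) fun f hf => hG _ hf
  refine ⟨RealRMK.rieszMeasure Λ, fun p hp => ?_⟩
  have hcut (n : ℕ) : ∫⁻ x, ENNReal.ofReal (cutPoly p n x) ∂(RealRMK.rieszMeasure Λ) =
      ENNReal.ofReal (G (compactlySupportedIncl (cutPoly p n))) := by
    rw [← ofReal_integral_eq_lintegral_ofReal, RealRMK.integral_rieszMeasure]
    · rfl
    · exact (cutPoly p n).continuous.integrable_of_hasCompactSupport (cutPoly p n).hasCompactSupport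
    · exact .of_forall fun x => mul_nonneg (hp x) (cutoff_nonneg n x)
  have hlim := lintegral_tendsto_of_tendsto_of_monotone (μ := RealRMK.rieszMeasure Λ)
    (f := fun n x => ENNReal.ofReal (cutPoly p n x))
    (fun n => (cutPoly p n).continuous.measurable.ennreal_ofReal.aemeasurable)
    (.of_forall fun x m n h => ENNReal.ofReal_le_ofReal
      (mul_le_mul_of_nonneg_left (monotone_cutoff x h) (hp x)))
    (.of_forall fun x => ENNReal.tendsto_ofReal (tendsto_cutPoly p x))
  simp only [hcut] at hlim
  exact tendsto_nhds_unique hlim (ENNReal.tendsto_ofReal (tendsto_map_cutPoly hG hp))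

theorem haviland_exists_measure {L : ℝ[X] →ₗ[ℝ] ℝ} (hL : ∀ p, (∀ x, 0 ≤ p.eval x) → 0 ≤ L p) :
    ∃ σ : Measure ℝ, ∀ p : ℝ[X], Integrable (fun x => p.eval x) σ ∧ ∫ x, p.eval x ∂σ = L p := by
  obtain ⟨G, hGL, hG⟩ := exists_nonneg_extension hL
  obtain ⟨σ, hσ⟩ := exists_measure_lintegral_eq hG
  have hnonneg (p : ℝ[X]) (hp : ∀ x, 0 ≤ p.eval x) :
      Integrable (fun x => p.eval x) σ ∧ ∫ x, p.eval x ∂σ = L p := by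
    have hmeas : AEStronglyMeasurable (fun x => p.eval x) σ := p.continuous.aestronglyMeasurable
    constructor
    · refine ⟨hmeas, ?_⟩
      rw [hasFiniteIntegral_iff_ofReal (.of_forall hp), hσ p hp]
      exact ENNReal.ofReal_lt_top
    · rw [integral_eq_lintegral_of_nonneg_ae (.of_forall hp) hmeas, hσ p hp, hGL,
        ENNReal.toReal_ofReal (hL p hp)]
  refine ⟨σ, fun p => ?_⟩
  obtain ⟨hint₁, heq₁⟩ := hnonneg ((p + 1) ^ 2) fun x => by rw [eval_pow]; positivity
  obtain ⟨hint₂, heq₂⟩ := hnonneg ((p - 1) ^ 2) fun x => by rw [eval_pow]; positivity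
  have hp : p = (1 / 4 : ℝ) • ((p + 1) ^ 2 - (p - 1) ^ 2) := by
    rw [show (p + 1) ^ 2 - (p - 1) ^ 2 = (4 : ℝ) • p by rw [smul_eq_C_mul, C_ofNat]; ring,
      smul_smul]
    norm_num
  rw [hp]
  simp only [eval_smul, eval_sub, smul_eq_mul, map_smul, map_sub]
  exact ⟨(hint₁.sub hint₂).const_mul _, by
    rw [integral_const_mul, integral_sub hint₁ hint₂, heq₁, heq₂]⟩

theorem hamburger_exists_measure {L : ℝ[X] →ₗ[ℝ] ℝ} (hL : ∀ p, 0 ≤ L (p ^ 2)) :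
    ∃ σ : Measure ℝ, ∀ p : ℝ[X], Integrable (fun x => p.eval x) σ ∧ ∫ x, p.eval x ∂σ = L p := by
  refine haviland_exists_measure fun p hp => ?_
  obtain ⟨a, b, rfl⟩ := exists_eq_sq_add_sq_of_eval_nonneg p hp
  rw [map_add]
  exact add_nonneg (hL a) (hL b)

end Hamburger

/-! ### Triangular systems -/

/-- The span of the first `n` terms of a sequence of vectors. -/
def initialSpan (R : Type*) [Semiring R] {V : Type*} [AddCommMonoid V] [Module R V]
    (e : ℕ → V) (n : ℕ) : Submodule R V :=
  Submodule.span R (e '' Set.Iio n)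

section InitialSpan

variable {R V W : Type*} [Semiring R] [AddCommMonoid V] [Module R V] [AddCommMonoid W] [Module R W]
  {e : ℕ → V} {n : ℕ} {v : V}

theorem mem_initialSpan {k : ℕ} (h : k < n) : e k ∈ initialSpan R e n :=
  Submodule.subset_span ⟨k, h, rfl⟩

theorem initialSpan_mono : Monotone (initialSpan R e) := fun _ _ h =>
  Submodule.span_mono (Set.image_mono (Set.Iio_subset_Iio h))

theorem initialSpan_le {p : Submodule R V} (h : ∀ k < n, e k ∈ p) : initialSpan R e n ≤ p :=
  Submodule.span_le.2 (Set.image_subset_iff.2 h)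

theorem mem_initialSpan_iff_exists_sum :
    v ∈ initialSpan R e n ↔ ∃ c : ℕ → R, ∑ k ∈ Finset.range n, c k • e k = v := by
  rw [initialSpan, ← Finset.coe_range, Submodule.mem_span_image_finset_iff_exists_fun']

theorem map_mem_initialSpan (B : V →ₗ[R] W) (hv : v ∈ initialSpan R e n) :
    B v ∈ initialSpan R (B ∘ e) n := by
  rw [initialSpan, Set.image_comp, ← Submodule.map_span]
  exact Submodule.mem_map_of_mem hv

end InitialSpan

/-- `v` is a positive multiple of `e n` up to a combination of `e 0, …, e (n - 1)`. For the
monomials in `ℝ[X]` these are the polynomials of degree `n` with positive leading coefficient. -/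
def HasPosLeadingTerm (R : Type*) [Field R] [LinearOrder R] {V : Type*} [AddCommGroup V]
    [Module R V] (e : ℕ → V) (n : ℕ) (v : V) : Prop :=
  ∃ a : R, 0 < a ∧ v - a • e n ∈ initialSpan R e n

theorem repr_eq_zero_of_mem_initialSpan {R K V : Type*} [CommSemiring R] [Semiring K] [Algebra R K]
    [AddCommMonoid V] [Module R V] [Module K V] [IsScalarTower R K V] {b : Module.Basis ℕ K V}
    {n k : ℕ} {v : V} (hv : v ∈ initialSpan R b n) (h : n ≤ k) :
    b.repr v k = 0 := by
  refine initialSpan_le (p := LinearMap.ker ((b.coord k).restrictScalars R)) (fun j hj => ?_) hv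
  simp [(hj.trans_le h).ne]

section Triangular

variable {R V W : Type*} [Field R] [LinearOrder R] [AddCommGroup V] [Module R V]
  [AddCommGroup W] [Module R W] {e f : ℕ → V} {n : ℕ} {v : V}

namespace HasPosLeadingTerm

theorem self [IsStrictOrderedRing R] (e : ℕ → V) (n : ℕ) : HasPosLeadingTerm R e n (e n) :=
  ⟨1, one_pos, by simp⟩

theorem mem_initialSpan (hv : HasPosLeadingTerm R e n v) {N : ℕ} (h : n < N) :
    v ∈ initialSpan R e N := by
  obtain ⟨a, -, ha⟩ := hv
  rw [← sub_add_cancel v (a • e n)]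
  exact add_mem (initialSpan_mono h.le ha)
    (Submodule.smul_mem _ _ (JacobiPencil.mem_initialSpan h))

theorem add_mem (hv : HasPosLeadingTerm R e n v) {w : V} (hw : w ∈ initialSpan R e n) :
    HasPosLeadingTerm R e n (v + w) := by
  obtain ⟨a, ha, hv⟩ := hv
  exact ⟨a, ha, by simpa only [add_sub_right_comm] using Submodule.add_mem _ hv hw⟩

theorem smul [IsStrictOrderedRing R] (hv : HasPosLeadingTerm R e n v) {c : R} (hc : 0 < c) :
    HasPosLeadingTerm R e n (c • v) := by
  obtain ⟨a, ha, hv⟩ := hv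
  exact ⟨c * a, mul_pos hc ha, by
    simpa only [smul_sub, smul_smul] using Submodule.smul_mem _ c hv⟩

theorem map (B : V →ₗ[R] W) (hv : HasPosLeadingTerm R e n v) :
    HasPosLeadingTerm R (B ∘ e) n (B v) := by
  obtain ⟨a, ha, hv⟩ := hv
  exact ⟨a, ha, by
    simpa only [map_sub, map_smul, Function.comp_apply] using map_mem_initialSpan B hv⟩

theorem iff_exists_sum : HasPosLeadingTerm R e n v ↔
    ∃ c : ℕ → R, 0 < c n ∧ v = c n • e n + ∑ k ∈ Finset.range n, c k • e k := by
  constructor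
  · rintro ⟨a, ha, hv⟩
    obtain ⟨c, hc⟩ := mem_initialSpan_iff_exists_sum.1 hv
    refine ⟨Function.update c n a, by simpa using ha, ?_⟩
    rw [Finset.sum_congr rfl fun k hk => by
      rw [Function.update_of_ne (Finset.mem_range.1 hk).ne], hc, Function.update_self,
      add_sub_cancel]
  · rintro ⟨c, hc, rfl⟩
    exact ⟨c n, hc, by
      rw [add_sub_cancel_left]
      exact mem_initialSpan_iff_exists_sum.2 ⟨c, rfl⟩⟩

variable [IsStrictOrderedRing R]

theorem sum {c : ℕ → R} (hf : ∀ k ≤ n, HasPosLeadingTerm R e k (f k)) (hc : 0 < c n) :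
    HasPosLeadingTerm R e n (∑ k ∈ Finset.range (n + 1), c k • f k) := by
  rw [Finset.sum_range_succ, add_comm]
  exact ((hf n le_rfl).smul hc).add_mem <| Submodule.sum_mem _ fun k hk =>
    have hk := Finset.mem_range.1 hk
    Submodule.smul_mem _ _ ((hf k hk.le).mem_initialSpan hk)

theorem of_smul {c : R} (hc : 0 < c) (hv : HasPosLeadingTerm R e n (c • v)) :
    HasPosLeadingTerm R e n v := by
  simpa only [inv_smul_smul₀ hc.ne'] using hv.smul (inv_pos.2 hc)

theorem trans {d : ℕ} (hf : ∀ k, HasPosLeadingTerm R e (k + d) (f k))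
    (hv : HasPosLeadingTerm R f n v) : HasPosLeadingTerm R e (n + d) v := by
  obtain ⟨a, ha, hv⟩ := hv
  have hle : initialSpan R f n ≤ initialSpan R e (n + d) :=
    initialSpan_le fun k hk => (hf k).mem_initialSpan (by omega)
  simpa only [add_sub_cancel] using ((hf n).smul ha).add_mem (hle hv)

theorem symm (hf : ∀ k, HasPosLeadingTerm R e k (f k)) (n : ℕ) :
    HasPosLeadingTerm R f n (e n) := by
  induction n using Nat.strong_induction_on with
  | _ n ih =>
  obtain ⟨a, ha, hn⟩ := hf n
  have hle : initialSpan R e n ≤ initialSpan R f n :=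
    initialSpan_le fun k hk => (ih k hk).mem_initialSpan hk
  refine of_smul ha ?_
  simpa only [neg_sub, add_sub_cancel] using (self f n).add_mem (neg_mem (hle hn))

variable {K : Type*} [Semiring K] [Module K V] [LinearMap.CompatibleSMul V V R K]

theorem basis_change {B : Module.End K V} {d : ℕ}
    (hB : ∀ k, HasPosLeadingTerm R e (k + d) (B (e k)))
    (hf : ∀ k, HasPosLeadingTerm R e k (f k)) (n : ℕ) :
    HasPosLeadingTerm R f (n + d) (B (f n)) :=
  trans (d := 0) (symm hf) (trans hB ((hf n).map (B.restrictScalars R)))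

theorem pow_apply {B : Module.End K V} (hB : ∀ k, HasPosLeadingTerm R e (k + 1) (B (e k)))
    (n : ℕ) : HasPosLeadingTerm R e n ((B ^ n) (e 0)) := by
  induction n with
  | zero => exact self e 0
  | succ n ih =>
    rw [pow_succ', Module.End.mul_apply]
    exact trans hB (ih.map (B.restrictScalars R))

end HasPosLeadingTerm

section Basis

variable {K : Type*} [Ring K] [Algebra R K] [Module K V]
  [IsScalarTower R K V] {b : Module.Basis ℕ K V}

theorem linearIndependent_of_hasPosLeadingTerm (hf : ∀ n, HasPosLeadingTerm R b n (f n)) :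
    LinearIndependent K f := by
  rw [linearIndependent_iff]
  intro l hl
  by_contra hl0
  set n := l.support.max' (Finsupp.support_nonempty_iff.2 hl0)
  have hn : n ∈ l.support := l.support.max'_mem _
  obtain ⟨a, ha, hfn⟩ := hf n
  have hlead : b.repr (f n) n = a • (1 : K) := by
    have := repr_eq_zero_of_mem_initialSpan hfn le_rfl
    rw [← algebraMap_smul K a (b n), map_sub, map_smul] at this
    simpa [sub_eq_zero, Algebra.algebraMap_eq_smul_one] using this
  have hzero : ∑ k ∈ l.support, l k * b.repr (f k) n = 0 := by
    simpa [Finsupp.linearCombination_apply, Finsupp.sum, Finsupp.finsetSum_apply] using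
      congrArg (fun w => b.repr w n) hl
  rw [Finset.sum_eq_single_of_mem n hn fun k hk hkn => by
    rw [repr_eq_zero_of_mem_initialSpan
      ((hf k).mem_initialSpan ((l.support.le_max' k hk).lt_of_ne hkn)) le_rfl, mul_zero],
    hlead, mul_smul_comm, mul_one] at hzero
  exact Finsupp.mem_support_iff.1 hn ((smul_eq_zero_iff_right ha.ne').1 hzero)

variable [IsStrictOrderedRing R]

theorem top_le_span_of_hasPosLeadingTerm (hf : ∀ n, HasPosLeadingTerm R b n (f n)) :
    ⊤ ≤ Submodule.span K (Set.range f) := by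
  rw [← b.span_eq, Submodule.span_le]
  rintro _ ⟨n, rfl⟩
  have hle : initialSpan R f (n + 1) ≤ (Submodule.span K (Set.range f)).restrictScalars R :=
    initialSpan_le fun k _ => Submodule.subset_span ⟨k, rfl⟩
  exact hle ((HasPosLeadingTerm.symm hf n).mem_initialSpan n.lt_succ_self)

/-- A sequence that is triangular with respect to a basis, as a basis. -/
def triangularBasis (hf : ∀ n, HasPosLeadingTerm R b n (f n)) : Module.Basis ℕ K V :=
  Module.Basis.mk (linearIndependent_of_hasPosLeadingTerm hf) (top_le_span_of_hasPosLeadingTerm hf)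

theorem coe_triangularBasis (hf : ∀ n, HasPosLeadingTerm R b n (f n)) :
    ⇑(triangularBasis hf) = f :=
  Module.Basis.coe_mk _ _

end Basis

end Triangular

theorem basisMonomials_apply_eq_X_pow {K : Type*} [Semiring K] (n : ℕ) :
    basisMonomials K n = X ^ n := by
  rw [coe_basisMonomials, X_pow_eq_monomial]

theorem initialSpan_basisMonomials {K : Type*} [CommRing K] (n : ℕ) :
    initialSpan K (basisMonomials K) n = degreeLT K n := by
  classical
  simp_rw [initialSpan, degreeLT_eq_span_X_pow, Finset.coe_image, Finset.coe_range,
    ← basisMonomials_apply_eq_X_pow]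

theorem hasPosLeadingTerm_basisMonomials_iff {K : Type*} [Field K] [LinearOrder K] {n : ℕ}
    {p : K[X]} : HasPosLeadingTerm K (basisMonomials K) n p ↔
      p.natDegree = n ∧ 0 < p.leadingCoeff := by
  simp only [HasPosLeadingTerm, initialSpan_basisMonomials, basisMonomials_apply_eq_X_pow,
    mem_degreeLT, smul_eq_C_mul]
  constructor
  · rintro ⟨a, ha, hlt⟩
    rw [← degree_C_mul_X_pow n ha.ne'] at hlt
    rw [← sub_add_cancel p (C a * X ^ n), natDegree_add_eq_right_of_degree_lt hlt,
      leadingCoeff_add_of_degree_lt hlt, leadingCoeff_C_mul_X_pow]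
    exact ⟨natDegree_C_mul_X_pow n a ha.ne', ha⟩
  · rintro ⟨rfl, hpos⟩
    refine ⟨p.leadingCoeff, hpos, ?_⟩
    rw [self_sub_C_mul_X_pow, ← degree_eq_natDegree (leadingCoeff_ne_zero.1 hpos.ne')]
    exact degree_eraseLead_lt (leadingCoeff_ne_zero.1 hpos.ne')

theorem hasPosLeadingTerm_X_mul {R K : Type*} [Field R] [LinearOrder R] [IsStrictOrderedRing R]
    [CommRing K] [Algebra R K] {n : ℕ} {p : K[X]}
    (hp : HasPosLeadingTerm R (basisMonomials K) n p) :
    HasPosLeadingTerm R (basisMonomials K) (n + 1) (X * p) := by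
  have hX (k : ℕ) : (LinearMap.mulLeft R X ∘ basisMonomials K) k = basisMonomials K (k + 1) := by
    rw [Function.comp_apply, LinearMap.mulLeft_apply, basisMonomials_apply_eq_X_pow, ← pow_succ',
      basisMonomials_apply_eq_X_pow]
  have hmap := hp.map (LinearMap.mulLeft R X)
  rw [LinearMap.mulLeft_apply] at hmap
  exact .trans (fun k => hX k ▸ .self (basisMonomials K) (k + 1)) hmap

theorem exists_linearEquiv_aeval {R K V : Type*} [Field R] [LinearOrder R] [IsStrictOrderedRing R]
    [CommRing K] [Algebra R K] [AddCommGroup V] [Module R V] [Module K V] [IsScalarTower R K V]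
    {b : Module.Basis ℕ K V} {B : Module.End K V}
    (hB : ∀ k, HasPosLeadingTerm R b (k + 1) (B (b k))) :
    ∃ e : K[X] ≃ₗ[K] V, ∀ u, e u = aeval B u (b 0) := by
  let c := triangularBasis (HasPosLeadingTerm.pow_apply hB)
  let e := (basisMonomials K).equiv c (Equiv.refl ℕ)
  have he : e.toLinearMap = (LinearMap.applyₗ (b 0)).comp (aeval B).toLinearMap :=
    (basisMonomials K).ext fun n => by
      rw [LinearEquiv.coe_coe, Module.Basis.equiv_apply, Equiv.refl_apply, coe_triangularBasis,
        basisMonomials_apply_eq_X_pow, LinearMap.comp_apply, AlgHom.toLinearMap_apply, aeval_X_pow,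
        LinearMap.applyₗ_apply_apply]
  exact ⟨e, LinearMap.congr_fun he⟩

theorem aeval_conj_mulLeft_X {K V : Type*} [CommRing K] [AddCommGroup V] [Module K V]
    (e : K[X] ≃ₗ[K] V) (u : K[X]) :
    aeval (e.conj (LinearMap.mulLeft K X)) u (e 1) = e u := by
  have hmul : aeval (Algebra.lmul K K[X] X) u 1 = u := by
    rw [aeval_algHom_apply, aeval_X_left_apply, Algebra.coe_lmul_eq_mul,
      LinearMap.mul_apply_apply, mul_one]
  change aeval (e.conjAlgEquiv K (Algebra.lmul K K[X] X)) u (e 1) = e u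
  rw [aeval_algHom_apply, LinearEquiv.conjAlgEquiv_apply, LinearMap.comp_apply,
    LinearMap.comp_apply, LinearEquiv.coe_coe, LinearEquiv.coe_coe, e.symm_apply_apply, hmul]

theorem hasPosLeadingTerm_gramSchmidtNormed {E : Type*} [NormedAddCommGroup E]
    [InnerProductSpace ℝ E] {f : ℕ → E} (hf : LinearIndependent ℝ f) (n : ℕ) :
    HasPosLeadingTerm ℝ f n (InnerProductSpace.gramSchmidtNormed ℝ f n) := by
  have hpos : 0 < ‖InnerProductSpace.gramSchmidt ℝ f n‖ :=
    norm_pos_iff.2 (InnerProductSpace.gramSchmidt_ne_zero n hf)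
  refine HasPosLeadingTerm.smul ⟨1, one_pos, ?_⟩ (inv_pos.2 hpos)
  rw [one_smul, initialSpan, ← InnerProductSpace.span_gramSchmidt_Iio ℝ,
    InnerProductSpace.gramSchmidt_def, sub_sub_cancel_left]
  refine neg_mem (sum_mem fun k hk => ?_)
  have hle : (ℝ ∙ InnerProductSpace.gramSchmidt ℝ f k) ≤
      Submodule.span ℝ (InnerProductSpace.gramSchmidt ℝ f '' Set.Iio n) :=
    Submodule.span_mono (Set.singleton_subset_iff.2 ⟨k, Finset.mem_Iio.1 hk, rfl⟩)
  exact hle (Submodule.starProjection_apply_mem _ _)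

/-! ### Band matrices in orthonormal systems -/

section Orthonormal

variable {𝕜 E : Type*} [RCLike 𝕜] [NormedAddCommGroup E] [InnerProductSpace 𝕜 E] {e : ℕ → E}

/-- The matrix of an operator with respect to an orthonormal system in which its matrix entries are
real. -/
def realMatrix (e : ℕ → E) (T : E →ₗ[𝕜] E) : Matrix ℕ ℕ ℝ :=
  Matrix.of fun m n => RCLike.re (inner 𝕜 (e m) (T (e n)))

theorem realMatrix_isSymm (e : ℕ → E) {T : E →ₗ[𝕜] E} (hT : T.IsSymmetric) :
    (realMatrix e T).IsSymm :=
  Matrix.IsSymm.ext fun m n => by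
    simp only [realMatrix, Matrix.of_apply]
    rw [← hT, inner_re_symm]

theorem inner_map_symm_of_isSymm_matrix {V : Type*} [AddCommGroup V] [Module 𝕜 V] [Module ℝ V]
    [IsScalarTower ℝ 𝕜 V] {b : Module.Basis ℕ 𝕜 V} {φ : V →ₗ[𝕜] E} (hφ : Orthonormal 𝕜 (φ ∘ b))
    {d : ℕ} {J : Matrix ℕ ℕ ℝ} (hJ : J.IsSymm) (hband : ∀ m n, n + d < m → J m n = 0)
    {T : V →ₗ[𝕜] V}
    (hT : ∀ n, T (b n) = ∑ m ∈ Finset.range (n + d + 1), J n m • b m) (x y : V) :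
    inner 𝕜 (φ (T x)) (φ y) = inner 𝕜 (φ x) (φ (T y)) := by
  have hinner (k n : ℕ) : inner 𝕜 (φ (b k)) (φ (T (b n))) = (J k n : 𝕜) := by
    have hδ (m : ℕ) : inner 𝕜 (φ (b k)) (φ (b m)) = if k = m then (1 : 𝕜) else 0 :=
      orthonormal_iff_ite.1 hφ k m
    simp_rw [hT, ← algebraMap_smul 𝕜 (J _ _) (b _), map_sum, map_smul, inner_sum,
      inner_smul_right, hδ, mul_ite, mul_one, mul_zero, Finset.sum_ite_eq,
      RCLike.algebraMap_eq_ofReal]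
    split_ifs with hk
    · rw [hJ.apply k n]
    · rw [hband k n (by simpa [Nat.lt_succ_iff] using hk), RCLike.ofReal_zero]
  have hform : ((innerₛₗ 𝕜).comp (φ ∘ₗ T)).compl₂ φ =
      ((innerₛₗ 𝕜).comp φ).compl₂ (φ ∘ₗ T) := by
    refine LinearMap.ext_basis b b fun m n => ?_
    change inner 𝕜 (φ (T (b m))) (φ (b n)) = inner 𝕜 (φ (b m)) (φ (T (b n)))
    rw [← inner_conj_symm, hinner, hinner, RCLike.conj_ofReal, hJ.apply]
  exact LinearMap.congr_fun₂ hform x y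

variable [Module ℝ E] [IsScalarTower ℝ 𝕜 E] {n d : ℕ} {v : E} {T : E →ₗ[𝕜] E}

theorem inner_eq_zero_of_mem_initialSpan (he : Orthonormal 𝕜 e) (hv : v ∈ initialSpan ℝ e n)
    {k : ℕ} (h : n ≤ k) : inner 𝕜 (e k) v = 0 :=
  initialSpan_le (p := LinearMap.ker ((innerₛₗ 𝕜 (e k)).restrictScalars ℝ))
    (fun _ hj => he.inner_eq_zero (hj.trans_le h).ne') hv

theorem ofReal_re_inner_of_mem_initialSpan (he : Orthonormal 𝕜 e) (hv : v ∈ initialSpan ℝ e n)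
    (k : ℕ) : (RCLike.re (inner 𝕜 (e k) v) : 𝕜) = inner 𝕜 (e k) v := by
  obtain ⟨c, rfl⟩ := mem_initialSpan_iff_exists_sum.1 hv
  simp_rw [← algebraMap_smul 𝕜 (c _) (e _), inner_sum, inner_smul_right,
    orthonormal_iff_ite.1 he, mul_ite, mul_one, mul_zero, Finset.sum_ite_eq]
  split_ifs <;> simp

theorem HasPosLeadingTerm.re_inner_pos (hv : HasPosLeadingTerm ℝ e n v) (he : Orthonormal 𝕜 e) :
    0 < RCLike.re (inner 𝕜 (e n) v) := by
  obtain ⟨a, ha, hv⟩ := hv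
  have hinner := inner_eq_zero_of_mem_initialSpan he hv le_rfl
  rw [← algebraMap_smul 𝕜 a (e n), inner_sub_right, inner_smul_right,
    inner_self_eq_norm_sq_to_K, he.1, sub_eq_zero] at hinner
  simpa [hinner] using ha

theorem sum_inner_smul_of_mem_initialSpan (he : Orthonormal 𝕜 e) (hv : v ∈ initialSpan ℝ e n) :
    ∑ k ∈ Finset.range n, inner 𝕜 (e k) v • e k = v := by
  obtain ⟨c, rfl⟩ := mem_initialSpan_iff_exists_sum.1 hv
  refine Finset.sum_congr rfl fun k hk => ?_
  simp_rw [← algebraMap_smul 𝕜 (c _) (e _)]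
  rw [he.inner_right_sum _ hk]

theorem realMatrix_pos (he : Orthonormal 𝕜 e)
    (hT : ∀ n, HasPosLeadingTerm ℝ e (n + d) (T (e n))) (n : ℕ) :
    0 < realMatrix e T (n + d) n :=
  (hT n).re_inner_pos he

theorem realMatrix_eq_zero (he : Orthonormal 𝕜 e)
    (hT : ∀ n, HasPosLeadingTerm ℝ e (n + d) (T (e n))) (m n : ℕ) (h : n + d < m) :
    realMatrix e T m n = 0 := by
  rw [realMatrix, Matrix.of_apply,
    inner_eq_zero_of_mem_initialSpan he ((hT n).mem_initialSpan (n + d).lt_succ_self) h, map_zero]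

theorem ofReal_realMatrix (he : Orthonormal 𝕜 e)
    (hT : ∀ n, HasPosLeadingTerm ℝ e (n + d) (T (e n))) (m n : ℕ) :
    (realMatrix e T m n : 𝕜) = inner 𝕜 (e m) (T (e n)) :=
  ofReal_re_inner_of_mem_initialSpan he ((hT n).mem_initialSpan (n + d).lt_succ_self) m

theorem sum_realMatrix_smul (he : Orthonormal 𝕜 e) (hsymm : T.IsSymmetric)
    (hT : ∀ n, HasPosLeadingTerm ℝ e (n + d) (T (e n))) (n : ℕ) :
    ∑ m ∈ Finset.range (n + d + 1), realMatrix e T n m • e m = T (e n) := by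
  rw [← sum_inner_smul_of_mem_initialSpan he ((hT n).mem_initialSpan (n + d).lt_succ_self)]
  refine Finset.sum_congr rfl fun m _ => ?_
  rw [← ofReal_realMatrix he hT, ← (realMatrix_isSymm e hsymm).apply, ← RCLike.algebraMap_eq_ofReal,
    algebraMap_smul]

end Orthonormal

/-! ### Favard's theorem -/

section Admissible

variable {E : Type*} [NormedAddCommGroup E] [InnerProductSpace ℝ E] {φ : ℝ[X] →ₗ[ℝ] E}

theorem exists_eq_map_ofReal_add_I_mul (g : ℂ[X]) :
    ∃ a b : ℝ[X], g = a.map Complex.ofRealHom + C Complex.I * b.map Complex.ofRealHom := by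
  induction g using Polynomial.induction_on' with
  | add p q hp hq =>
    obtain ⟨a, b, rfl⟩ := hp
    obtain ⟨c, d, rfl⟩ := hq
    exact ⟨a + c, b + d, by simp only [Polynomial.map_add]; ring⟩
  | monomial n z =>
    refine ⟨monomial n z.re, monomial n z.im, ?_⟩
    simp only [map_monomial, C_mul_monomial, ← map_add, Complex.ofRealHom_eq_coe]
    rw [mul_comm, Complex.re_add_im]

theorem eval_map_ofReal (p : ℝ[X]) (x : ℝ) :
    (p.map Complex.ofRealHom).eval (x : ℂ) = (p.eval x : ℝ) :=
  eval_map_apply Complex.ofRealHom x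

theorem C_ofReal_mul (a : ℝ) (p : ℂ[X]) : C (a : ℂ) * p = a • p := by
  rw [← smul_eq_C_mul]
  exact algebraMap_smul ℂ a p

theorem inner_mul_symm (hX : ∀ u v, inner ℝ (φ (X * u)) (φ v) = inner ℝ (φ u) (φ (X * v)))
    (q u v : ℝ[X]) : inner ℝ (φ (q * u)) (φ v) = inner ℝ (φ u) (φ (q * v)) := by
  induction q using Polynomial.induction_on generalizing u v with
  | C a => simp only [← smul_eq_C_mul, map_smul, real_inner_smul_left, real_inner_smul_right]
  | add p q hp hq => simp only [add_mul, map_add, inner_add_left, inner_add_right, hp, hq]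
  | monomial n a ih =>
    rw [pow_succ, ← mul_assoc, mul_assoc _ X u, ih, hX, mul_left_comm, ← mul_assoc]

theorem exists_measure_integral_mul_eq_inner
    (hX : ∀ u v, inner ℝ (φ (X * u)) (φ v) = inner ℝ (φ u) (φ (X * v))) :
    ∃ σ : Measure ℝ, (∀ p : ℝ[X], Integrable (fun x => p.eval x) σ) ∧
      ∀ u v : ℝ[X], ∫ x, u.eval x * v.eval x ∂σ = inner ℝ (φ u) (φ v) := by
  obtain ⟨σ, hσ⟩ := hamburger_exists_measure (L := (innerₗ E (φ 1)).comp φ) fun p => by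
    rw [LinearMap.comp_apply, innerₗ_apply_apply, sq, ← inner_mul_symm hX, mul_one]
    exact real_inner_self_nonneg
  refine ⟨σ, fun p => (hσ p).1, fun u v => ?_⟩
  simp_rw [← eval_mul]
  rw [(hσ _).2, LinearMap.comp_apply, innerₗ_apply_apply, ← inner_mul_symm hX, mul_one]

theorem exists_admissible_integral_mul_eq_inner (hφ : Function.Injective φ) (hone : ‖φ 1‖ = 1)
    (hX : ∀ u v, inner ℝ (φ (X * u)) (φ v) = inner ℝ (φ u) (φ (X * v))) :
    ∃ σ : Measure ℝ, Admissible σ ∧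
      ∀ u v : ℝ[X], ∫ x, u.eval x * v.eval x ∂σ = inner ℝ (φ u) (φ v) := by
  obtain ⟨σ, hint, hσ⟩ := exists_measure_integral_mul_eq_inner hX
  refine ⟨σ, ⟨⟨?_⟩, fun n => by simpa only [eval_pow, eval_X] using hint (X ^ n), fun g hg => ?_⟩,
    hσ⟩
  · have hmass := hσ 1 1
    rw [real_inner_self_eq_norm_sq, hone] at hmass
    simpa [Measure.real, ENNReal.toReal_eq_one_iff] using hmass
  obtain ⟨a, b, rfl⟩ := exists_eq_map_ofReal_add_I_mul g
  have hnorm (x : ℝ) : ‖(a.map Complex.ofRealHom + C Complex.I * b.map Complex.ofRealHom).eval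
      (x : ℂ)‖ ^ 2 = a.eval x * a.eval x + b.eval x * b.eval x := by
    rw [← Complex.normSq_eq_norm_sq, eval_add, eval_mul, eval_C, eval_map_ofReal, eval_map_ofReal,
      mul_comm Complex.I, Complex.normSq_add_mul_I, sq, sq]
  have hint_sq (p : ℝ[X]) : Integrable (fun x => p.eval x * p.eval x) σ := by
    simpa only [eval_mul] using hint (p * p)
  simp_rw [hnorm]
  rw [integral_add (hint_sq a) (hint_sq b), hσ, hσ]
  by_cases ha : a = 0
  · have hb : b ≠ 0 := by rintro rfl; simp [ha] at hg
    exact add_pos_of_nonneg_of_pos real_inner_self_nonneg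
      (real_inner_self_pos.2 ((map_ne_zero_iff φ hφ).2 hb))
  · exact add_pos_of_pos_of_nonneg (real_inner_self_pos.2 ((map_ne_zero_iff φ hφ).2 ha))
      real_inner_self_nonneg

end Admissible

section Favard

variable {J : Matrix ℕ ℕ ℝ}

/-- The polynomials with `r 0 = 1` and `∑ m ≤ n + 1, J n m • r m = X * r n`, the orthonormal
polynomials of `J` if `J` is a Jacobi matrix. -/
def recurrencePoly (J : Matrix ℕ ℕ ℝ) : ℕ → ℝ[X]
  | 0 => 1
  | n + 1 => (J n (n + 1))⁻¹ •
      (X * recurrencePoly J n - ∑ m : Fin (n + 1), J n m • recurrencePoly J m)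

theorem recurrencePoly_zero : recurrencePoly J 0 = 1 := by
  rw [recurrencePoly]

theorem recurrencePoly_succ (n : ℕ) : recurrencePoly J (n + 1) = (J n (n + 1))⁻¹ •
    (X * recurrencePoly J n - ∑ m ∈ Finset.range (n + 1), J n m • recurrencePoly J m) := by
  rw [recurrencePoly, ← Fin.sum_univ_eq_sum_range (fun m => J n m • recurrencePoly J m)]

theorem sum_smul_recurrencePoly (hpos : ∀ n, 0 < J n (n + 1)) (n : ℕ) :
    ∑ m ∈ Finset.range (n + 2), J n m • recurrencePoly J m = X * recurrencePoly J n := by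
  rw [Finset.sum_range_succ, recurrencePoly_succ, smul_inv_smul₀ (hpos n).ne', add_sub_cancel]

theorem hasPosLeadingTerm_recurrencePoly (hpos : ∀ n, 0 < J n (n + 1)) (n : ℕ) :
    HasPosLeadingTerm ℝ (basisMonomials ℝ) n (recurrencePoly J n) := by
  induction n using Nat.strong_induction_on with
  | _ n ih =>
  cases n with
  | zero => simpa [recurrencePoly_zero] using HasPosLeadingTerm.self (R := ℝ) (basisMonomials ℝ) 0
  | succ n =>
    rw [recurrencePoly_succ, sub_eq_add_neg]
    refine ((hasPosLeadingTerm_X_mul (ih n n.lt_succ_self)).add_mem (neg_mem ?_)).smul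
      (inv_pos.2 (hpos n))
    exact sum_mem fun m hm => Submodule.smul_mem _ _
      ((ih m (Finset.mem_range.1 hm)).mem_initialSpan (Finset.mem_range.1 hm))

theorem favard_exists_isOrthonormalSystem (hJ : J.IsSymm)
    (htri : ∀ m n, n + 1 < m → J m n = 0) (hpos : ∀ n, 0 < J n (n + 1)) :
    ∃ σ : Measure ℝ, Admissible σ ∧ IsOrthonormalSystem σ (recurrencePoly J) := by
  have hlead := hasPosLeadingTerm_recurrencePoly hpos
  let b := triangularBasis hlead
  have hb : ⇑b = recurrencePoly J := coe_triangularBasis hlead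
  let e : HilbertBasis ℕ ℝ (lp (fun _ : ℕ => ℝ) 2) := .ofRepr (.refl ℝ _)
  let φ := b.constr ℝ e
  have hφ : φ ∘ b = e := funext (b.constr_basis ℝ e)
  have horth : Orthonormal ℝ (φ ∘ b) := hφ ▸ e.orthonormal
  have hinj : Function.Injective φ :=
    b.injective_constr_of_linearIndependent e.orthonormal.linearIndependent
  have hX := inner_map_symm_of_isSymm_matrix (T := LinearMap.mulLeft ℝ X) horth hJ htri fun n => by
    rw [LinearMap.mulLeft_apply, hb, ← sum_smul_recurrencePoly hpos]
  obtain ⟨σ, hσ, hinner⟩ := exists_admissible_integral_mul_eq_inner hinj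
    (by rw [← recurrencePoly_zero (J := J), ← hb]; exact horth.1 0) hX
  refine ⟨σ, hσ, fun n => (hasPosLeadingTerm_basisMonomials_iff.1 (hlead n)).1,
    fun n => (hasPosLeadingTerm_basisMonomials_iff.1 (hlead n)).2, fun n m => ?_⟩
  rw [hinner, ← hb]
  exact orthonormal_iff_ite.1 horth n m

end Favard

/-! ### The space of classes of polynomials -/

section ModelSpace

variable {σ : Measure ℝ} (hσ : Admissible σ)

theorem Admissible.coeFn_cls (p : ℂ[X]) :
    (hσ.cls p : ℝ → ℂ) =ᵐ[σ] fun x : ℝ => p.eval (x : ℂ) :=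
  (hσ.memLp p).coeFn_toLp

theorem Admissible.inner_toPolys (u v : ℂ[X]) :
    inner ℂ (hσ.toPolys u) (hσ.toPolys v) = ∫ x : ℝ, v.eval (x : ℂ) * conj (u.eval (x : ℂ)) ∂σ := by
  change inner ℂ (hσ.cls u) (hσ.cls v) = _
  rw [L2.inner_def]
  refine integral_congr_ae ?_
  filter_upwards [hσ.coeFn_cls u, hσ.coeFn_cls v] with x hu hv
  rw [hu, hv, RCLike.inner_apply]

theorem Admissible.cls_injective : Function.Injective hσ.cls := by
  rw [injective_iff_map_eq_zero]
  intro p hp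
  by_contra h
  refine (hσ.pos p h).ne' (integral_eq_zero_of_ae ?_)
  filter_upwards [hσ.coeFn_cls p, Lp.coeFn_zero ℂ 2 σ] with x hpx h0x
  rw [← hpx, hp, h0x]
  simp

/-- The identification of the complex polynomials with their classes in `L²_σ`. -/
def Admissible.polyEquiv : ℂ[X] ≃ₗ[ℂ] hσ.polys :=
  LinearEquiv.ofInjective hσ.cls hσ.cls_injective

/-- The powers `1, x, x², …` as a basis of the space of classes of polynomials. -/
def Admissible.powBasis : Module.Basis ℕ ℂ hσ.polys :=
  (basisMonomials ℂ).map hσ.polyEquiv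

theorem Admissible.powBasis_apply (n : ℕ) : hσ.powBasis n = hσ.toPolys (X ^ n) := by
  rw [Admissible.powBasis, Module.Basis.map_apply, basisMonomials_apply_eq_X_pow]
  rfl

theorem Admissible.mulX_toPolys (p : ℂ[X]) : hσ.mulX (hσ.toPolys p) = hσ.toPolys (X * p) :=
  Subtype.ext (MemLp.toLp_congr (hσ.mul_memLp (hσ.toPolys p)) (hσ.memLp (X * p)) (hσ.mul_ae p))

theorem Admissible.mulX_isSymmetric : hσ.mulX.IsSymmetric := by
  rintro ⟨_, u, rfl⟩ ⟨_, v, rfl⟩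
  change inner ℂ (hσ.mulX (hσ.toPolys u)) (hσ.toPolys v) =
    inner ℂ (hσ.toPolys u) (hσ.mulX (hσ.toPolys v))
  simp only [hσ.mulX_toPolys, hσ.inner_toPolys, eval_mul, eval_X, map_mul, Complex.conj_ofReal,
    mul_left_comm, mul_assoc]

/-- The class in `L²_σ` of a real polynomial. -/
def Admissible.realCls : ℝ[X] →ₗ[ℝ] hσ.polys :=
  (hσ.polyEquiv.toLinearMap.restrictScalars ℝ).comp (mapAlgHom Complex.ofRealAm).toLinearMap

theorem Admissible.realCls_apply (p : ℝ[X]) :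
    hσ.realCls p = hσ.toPolys (p.map Complex.ofRealHom) :=
  rfl

theorem Admissible.realCls_X_mul (p : ℝ[X]) :
    hσ.realCls (X * p) = hσ.mulX (hσ.realCls p) := by
  simp only [hσ.realCls_apply, hσ.mulX_toPolys, Polynomial.map_mul, map_X]

theorem Admissible.realCls_comp_basisMonomials :
    hσ.realCls ∘ basisMonomials ℝ = hσ.powBasis := by
  funext n
  rw [Function.comp_apply, basisMonomials_apply_eq_X_pow, hσ.realCls_apply, hσ.powBasis_apply,
    Polynomial.map_pow, map_X]

theorem Admissible.inner_realCls (a b : ℝ[X]) :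
    inner ℂ (hσ.realCls a) (hσ.realCls b) = ((∫ x, a.eval x * b.eval x ∂σ : ℝ) : ℂ) := by
  rw [hσ.realCls_apply, hσ.realCls_apply, hσ.inner_toPolys, ← integral_complex_ofReal]
  simp only [eval_map_ofReal, Complex.conj_ofReal, Complex.ofReal_mul, mul_comm]

theorem Admissible.realCls_injective : Function.Injective hσ.realCls :=
  hσ.polyEquiv.injective.comp (map_injective _ Complex.ofRealHom.injective)

theorem Admissible.hasPosLeadingTerm_mulX {v : hσ.polys} {n : ℕ}
    (hv : HasPosLeadingTerm ℝ hσ.powBasis n v) :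
    HasPosLeadingTerm ℝ hσ.powBasis (n + 1) (hσ.mulX v) := by
  have hX (k : ℕ) : (hσ.mulX.restrictScalars ℝ ∘ hσ.powBasis) k = hσ.powBasis (k + 1) := by
    simp only [Function.comp_apply, LinearMap.restrictScalars_apply, hσ.powBasis_apply,
      hσ.mulX_toPolys, pow_succ']
  exact .trans (fun k => hX k ▸ .self hσ.powBasis (k + 1)) (hv.map (hσ.mulX.restrictScalars ℝ))

theorem isExpansion_iff {𝒜 : Module.End ℂ hσ.polys} {ξ : ℕ → ℕ → ℝ} :
    IsExpansion hσ 𝒜 ξ ↔ ∀ k, 0 < ξ k (k + 1) ∧ 𝒜 (hσ.powBasis k) =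
      ξ k (k + 1) • hσ.powBasis (k + 1) + ∑ j ∈ Finset.range (k + 1), ξ k j • hσ.powBasis j := by
  have hC (a : ℝ) (p : ℂ[X]) : hσ.toPolys (C (a : ℂ) * p) = a • hσ.toPolys p := by
    rw [C_ofReal_mul]
    exact hσ.cls.rangeRestrict.map_smul_of_tower a p
  simp only [IsExpansion, hσ.powBasis_apply, map_add, map_sum, hC]

theorem exists_isExpansion_iff {𝒜 : Module.End ℂ hσ.polys} :
    (∃ ξ, IsExpansion hσ 𝒜 ξ) ↔
      ∀ k, HasPosLeadingTerm ℝ hσ.powBasis (k + 1) (𝒜 (hσ.powBasis k)) := by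
  simp_rw [isExpansion_iff, HasPosLeadingTerm.iff_exists_sum]
  refine ⟨fun ⟨ξ, hξ⟩ k => ⟨ξ k, hξ k⟩, fun h => ?_⟩
  choose ξ hξ using h
  exact ⟨ξ, hξ⟩

theorem represents_iff {𝒜 : Module.End ℂ hσ.polys} {S : ℂ[X] →ₗ[ℂ] ℂ[X] →ₗ⋆[ℂ] ℂ} :
    Represents hσ 𝒜 S ↔ ∀ u v, S u v =
      inner ℂ (aeval 𝒜 v (hσ.powBasis 0)) (aeval 𝒜 u (hσ.powBasis 0)) := by
  simp only [Represents, hσ.powBasis_apply, pow_zero, Submodule.coe_inner, L2.inner_def,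
    RCLike.inner_apply]

end ModelSpace

section OrthonormalSystem

variable {σ : Measure ℝ} {r : ℕ → ℝ[X]}

theorem IsOrthonormalSystem.hasPosLeadingTerm (hr : IsOrthonormalSystem σ r) (n : ℕ) :
    HasPosLeadingTerm ℝ (basisMonomials ℝ) n (r n) :=
  hasPosLeadingTerm_basisMonomials_iff.2 ⟨hr.natDegree_eq n, hr.leadingCoeff_pos n⟩

theorem IsOrthonormalSystem.hasPosLeadingTerm_realCls (hr : IsOrthonormalSystem σ r)
    (hσ : Admissible σ) (n : ℕ) :
    HasPosLeadingTerm ℝ hσ.powBasis n ((hσ.realCls ∘ r) n) :=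
  hσ.realCls_comp_basisMonomials ▸ (hr.hasPosLeadingTerm n).map hσ.realCls

theorem IsOrthonormalSystem.orthonormal_realCls (hr : IsOrthonormalSystem σ r)
    (hσ : Admissible σ) : Orthonormal ℂ (hσ.realCls ∘ r) :=
  orthonormal_iff_ite.2 fun n m => by
    rw [Function.comp_apply, Function.comp_apply, hσ.inner_realCls, hr.orthonormal]
    split_ifs <;> simp

/-- The scalar product of `L²_σ` on the real polynomials. -/
@[reducible]
def Admissible.realCore (hσ : Admissible σ) : InnerProductSpace.Core ℝ ℝ[X] where
  inner p q := (inner ℂ (hσ.realCls p) (hσ.realCls q)).re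
  conj_inner_symm p q := inner_re_symm (𝕜 := ℂ) (hσ.realCls q) (hσ.realCls p)
  re_inner_nonneg p := inner_self_nonneg (𝕜 := ℂ) (x := hσ.realCls p)
  add_left p q s := by rw [map_add, inner_add_left, Complex.add_re]
  smul_left p q c := by
    rw [map_smul, ← algebraMap_smul ℂ c (hσ.realCls p), inner_smul_left]
    simp
  definite p hp := by
    have hnorm : ‖hσ.realCls p‖ ^ 2 = 0 := by rw [norm_sq_eq_re_inner (𝕜 := ℂ)]; exact hp
    simpa [hσ.realCls_injective.eq_iff' (map_zero _)] using hnorm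

theorem exists_isOrthonormalSystem (hσ : Admissible σ) :
    ∃ r : ℕ → ℝ[X], IsOrthonormalSystem σ r := by
  let _ : NormedAddCommGroup ℝ[X] := hσ.realCore.toNormedAddCommGroup
  let _ : InnerProductSpace ℝ ℝ[X] := .ofCore hσ.realCore.toCore
  have hinner (p q : ℝ[X]) : inner ℝ p q = ∫ x, p.eval x * q.eval x ∂σ := by
    change (inner ℂ (hσ.realCls p) (hσ.realCls q)).re = _
    rw [hσ.inner_realCls, Complex.ofReal_re]
  have hli : LinearIndependent ℝ (basisMonomials ℝ) := (basisMonomials ℝ).linearIndependent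
  have hlead (n : ℕ) := hasPosLeadingTerm_basisMonomials_iff.1
    (hasPosLeadingTerm_gramSchmidtNormed hli n)
  refine ⟨_, fun n => (hlead n).1, fun n => (hlead n).2, fun n m => ?_⟩
  rw [← hinner]
  exact orthonormal_iff_ite.1 (InnerProductSpace.gramSchmidtNormed_orthonormal hli) n m

theorem IsOrthonormalSystem.zero_eq_one (hr : IsOrthonormalSystem σ r)
    (hσ : Admissible σ) : r 0 = 1 := by
  have := hσ.prob
  obtain ⟨a, ha⟩ := natDegree_eq_zero.1 (hr.natDegree_eq 0)
  have hpos := hr.leadingCoeff_pos 0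
  have hnorm := hr.orthonormal 0 0
  simp only [← ha, leadingCoeff_C] at hpos
  simp only [← ha, eval_C, integral_const, probReal_univ, one_smul, if_true] at hnorm
  rw [← ha, (mul_self_eq_one_iff.1 hnorm).resolve_right (by linarith), C_1]

theorem IsOrthonormalSystem.exists_one_eq (hr : IsOrthonormalSystem σ r) (hσ : Admissible σ) :
    ∃ a : ℝ, 0 < a ∧ r 1 = C a * (X - C (∫ x, x ∂σ)) := by
  have := hσ.prob
  obtain ⟨a, ha, b, hab⟩ := natDegree_eq_one.1 (hr.natDegree_eq 1)
  have hpos := hr.leadingCoeff_pos 1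
  rw [← hab, leadingCoeff_linear ha] at hpos
  have hint : Integrable (fun x : ℝ => a * x) σ := by
    simpa only [pow_one] using (hσ.moments 1).const_mul a
  have horth : a * ∫ x, x ∂σ + b = 0 := by
    have h := hr.orthonormal 1 0
    simp only [hr.zero_eq_one hσ, ← hab, eval_add, eval_mul, eval_C, eval_X, eval_one, mul_one,
      one_ne_zero, if_false] at h
    rw [integral_add hint (integrable_const b), integral_const_mul] at h
    simpa using h
  refine ⟨a, hpos, ?_⟩
  rw [← hab, eq_neg_of_add_eq_zero_right horth, C_neg, C_mul]
  ring

theorem IsOrthonormalSystem.one_eq (hr : IsOrthonormalSystem σ r) (hσ : Admissible σ) :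
    0 < (∫ x, x ^ 2 ∂σ) - (∫ x, x ∂σ) ^ 2 ∧
      r 1 = C (1 / √((∫ x, x ^ 2 ∂σ) - (∫ x, x ∂σ) ^ 2)) * (X - C (∫ x, x ∂σ)) := by
  have := hσ.prob
  obtain ⟨a, ha, hone⟩ := hr.exists_one_eq hσ
  have hvar : ∫ x, (x - ∫ y, y ∂σ) ^ 2 ∂σ = (∫ x, x ^ 2 ∂σ) - (∫ x, x ∂σ) ^ 2 := by
    rw [← ProbabilityTheory.variance_eq_integral (X := fun x : ℝ => x) aemeasurable_id]
    exact ProbabilityTheory.variance_eq_sub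
      ((memLp_two_iff_integrable_sq aestronglyMeasurable_id).2 (hσ.moments 2))
  have hnorm : a ^ 2 * ((∫ x, x ^ 2 ∂σ) - (∫ x, x ∂σ) ^ 2) = 1 := by
    have h := hr.orthonormal 1 1
    simp only [hone, eval_mul, eval_C, eval_sub, eval_X, if_true] at h
    rw [← h, ← hvar, ← integral_const_mul]
    simp only [mul_pow, ← sq]
  have hpos := pos_of_mul_pos_right (hnorm ▸ one_pos) (sq_nonneg a)
  refine ⟨hpos, ?_⟩
  have ha_mul : a * √((∫ x, x ^ 2 ∂σ) - (∫ x, x ∂σ) ^ 2) = 1 := by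
    rw [← Real.sqrt_sq ha.le, ← Real.sqrt_mul (sq_nonneg a), hnorm, Real.sqrt_one]
  rw [← eq_one_div_of_mul_eq_one_left ha_mul, hone]

end OrthonormalSystem

/-! ### From a model to a pencil -/

theorem Pencil.sum_row_eq (Θ : Pencil) (p : ℕ → ℂ[X]) (n : ℕ) :
    ∑ m ∈ Finset.range (n + 3), (C (Θ.J₅ n m : ℂ) - X * C (Θ.J₃ n m : ℂ)) * p m =
      ∑ m ∈ Finset.range (n + 3), Θ.J₅ n m • p m -
        X * ∑ m ∈ Finset.range (n + 2), Θ.J₃ n m • p m := by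
  have hJ₃ : Θ.J₃ n (n + 2) = 0 := by
    rw [← Θ.J₃_symm.apply]
    exact Θ.J₃_tridiagonal (n + 2) n (by omega)
  simp_rw [sub_mul, mul_assoc, C_ofReal_mul, Finset.sum_sub_distrib, ← Finset.mul_sum]
  rw [Finset.sum_range_succ (fun m => Θ.J₃ n m • p m), hJ₃, zero_smul, add_zero]

section Reconstruction

variable {σ : Measure ℝ} {hσ : Admissible σ} {𝒜 : Module.End ℂ hσ.polys} {ξ : ℕ → ℕ → ℝ}
  {r : ℕ → ℝ[X]} {Θ : Pencil}

theorem IsOrthonormalSystem.hasPosLeadingTerm_mulX (hr : IsOrthonormalSystem σ r)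
    (hσ : Admissible σ) (n : ℕ) :
    HasPosLeadingTerm ℝ (hσ.realCls ∘ r) (n + 1) (hσ.mulX (hσ.realCls (r n))) :=
  .basis_change (fun k => hσ.hasPosLeadingTerm_mulX (.self hσ.powBasis k))
    (hr.hasPosLeadingTerm_realCls hσ) n

theorem IsOrthonormalSystem.hasPosLeadingTerm_comp_mulX (hr : IsOrthonormalSystem σ r)
    (hξ : IsExpansion hσ 𝒜 ξ) (n : ℕ) :
    HasPosLeadingTerm ℝ (hσ.realCls ∘ r) (n + 2) ((𝒜 ∘ₗ hσ.mulX) (hσ.realCls (r n))) := by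
  refine .basis_change (fun k => ?_) (hr.hasPosLeadingTerm_realCls hσ) n
  exact .trans (d := 1) (f := 𝒜 ∘ hσ.powBasis) ((exists_isExpansion_iff hσ).1 ⟨ξ, hξ⟩)
    ((hσ.hasPosLeadingTerm_mulX (.self hσ.powBasis k)).map (𝒜.restrictScalars ℝ))

theorem exists_isReconstructed (h𝒜 : (𝒜 ∘ₗ hσ.mulX).IsSymmetric) (hξ : IsExpansion hσ 𝒜 ξ)
    (hr : IsOrthonormalSystem σ r) : ∃ Θ, IsReconstructed hσ 𝒜 ξ r Θ := by
  have horth := hr.orthonormal_realCls hσ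
  have hJ₃ := hr.hasPosLeadingTerm_mulX hσ
  have hJ₅ := hr.hasPosLeadingTerm_comp_mulX hξ
  let Θ : Pencil :=
    { J₃ := realMatrix (hσ.realCls ∘ r) hσ.mulX
      J₅ := realMatrix (hσ.realCls ∘ r) (𝒜 ∘ₗ hσ.mulX)
      α := 1 / (ξ 0 1 * √((∫ x, x ^ 2 ∂σ) - (∫ x, x ∂σ) ^ 2))
      β := -(ξ 0 1 * (∫ x, x ∂σ) + ξ 0 0) / (ξ 0 1 * √((∫ x, x ^ 2 ∂σ) - (∫ x, x ∂σ) ^ 2))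
      J₃_symm := realMatrix_isSymm _ hσ.mulX_isSymmetric
      J₃_tridiagonal := realMatrix_eq_zero horth hJ₃
      J₃_pos := realMatrix_pos horth hJ₃
      J₅_symm := realMatrix_isSymm _ h𝒜
      J₅_fiveDiagonal := realMatrix_eq_zero horth hJ₅
      J₅_pos := realMatrix_pos horth hJ₅
      α_pos := one_div_pos.2 (mul_pos (hξ 0).1 (Real.sqrt_pos.2 (hr.one_eq hσ).1)) }
  refine ⟨Θ, fun n => hσ.realCls_injective ?_, ofReal_realMatrix horth hJ₅, rfl, rfl⟩
  simp_rw [map_sum, ← smul_eq_C_mul, map_smul, hσ.realCls_X_mul]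
  exact sum_realMatrix_smul horth hσ.mulX_isSymmetric hJ₃ n

theorem IsReconstructed.sum_J₃_smul (hΘ : IsReconstructed hσ 𝒜 ξ r Θ) (n : ℕ) :
    ∑ m ∈ Finset.range (n + 2), Θ.J₃ n m • hσ.realCls (r m) = hσ.mulX (hσ.realCls (r n)) := by
  rw [← hσ.realCls_X_mul, ← hΘ.J₃_eq, map_sum]
  simp_rw [← smul_eq_C_mul, map_smul]

theorem IsReconstructed.sum_J₅_smul (hΘ : IsReconstructed hσ 𝒜 ξ r Θ) (hξ : IsExpansion hσ 𝒜 ξ)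
    (hr : IsOrthonormalSystem σ r) (n : ℕ) :
    ∑ m ∈ Finset.range (n + 3), Θ.J₅ n m • hσ.realCls (r m) =
      𝒜 (hσ.mulX (hσ.realCls (r n))) := by
  rw [← LinearMap.comp_apply, ← sum_inner_smul_of_mem_initialSpan (hr.orthonormal_realCls hσ)
    ((hr.hasPosLeadingTerm_comp_mulX hξ n).mem_initialSpan (n + 2).lt_succ_self)]
  refine Finset.sum_congr rfl fun m _ => ?_
  rw [← Θ.J₅_symm.apply, ← algebraMap_smul ℂ (Θ.J₅ m n), Complex.coe_algebraMap, hΘ.J₅_eq]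
  rfl

theorem IsReconstructed.realCls_one_eq (hΘ : IsReconstructed hσ 𝒜 ξ r Θ)
    (hξ : IsExpansion hσ 𝒜 ξ) (hr : IsOrthonormalSystem σ r) :
    hσ.realCls (r 1) = Θ.α • 𝒜 (hσ.powBasis 0) + Θ.β • hσ.powBasis 0 := by
  obtain ⟨hv, hone⟩ := hr.one_eq hσ
  have hsqrt := (Real.sqrt_pos.2 hv).ne'
  obtain ⟨hξ₀₁, h𝒜⟩ := (isExpansion_iff hσ).1 hξ 0
  have hα : Θ.α * ξ 0 1 = 1 / √((∫ x, x ^ 2 ∂σ) - (∫ x, x ∂σ) ^ 2) := by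
    rw [hΘ.α_eq]
    field_simp
  have hβ : Θ.α * ξ 0 0 + Θ.β =
      -(1 / √((∫ x, x ^ 2 ∂σ) - (∫ x, x ∂σ) ^ 2) * ∫ x, x ∂σ) := by
    rw [hΘ.α_eq, hΘ.β_eq]
    field_simp
    ring
  have hlin : r 1 = (Θ.α * ξ 0 1) • basisMonomials ℝ 1 +
      (Θ.α * ξ 0 0 + Θ.β) • basisMonomials ℝ 0 := by
    simp_rw [hone, hα, hβ, basisMonomials_apply_eq_X_pow, smul_eq_C_mul, C_neg, C_mul]
    ring
  rw [hlin, map_add, map_smul, map_smul, ← Function.comp_apply (f := hσ.realCls),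
    ← Function.comp_apply (f := hσ.realCls), hσ.realCls_comp_basisMonomials, h𝒜,
    Finset.sum_range_one, smul_add, smul_smul, smul_smul, add_smul, add_assoc]

theorem IsReconstructed.isSpectralFunction {S : ℂ[X] →ₗ[ℂ] ℂ[X] →ₗ⋆[ℂ] ℂ}
    (hΘ : IsReconstructed hσ 𝒜 ξ r Θ) (hξ : IsExpansion hσ 𝒜 ξ) (hr : IsOrthonormalSystem σ r)
    (hS : Represents hσ 𝒜 S) : Θ.IsSpectralFunction S := by
  obtain ⟨e, he⟩ := exists_linearEquiv_aeval ((exists_isExpansion_iff hσ).1 ⟨ξ, hξ⟩)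
  have he_one : e 1 = hσ.powBasis 0 := by rw [he, map_one, Module.End.one_apply]
  have he_X (u : ℂ[X]) : e (X * u) = 𝒜 (e u) := by
    rw [he, he, map_mul, Module.End.mul_apply, aeval_X]
  have he_smul (a : ℝ) (u : ℂ[X]) : e (a • u) = a • e u := e.toLinearMap.map_smul_of_tower a u
  refine ⟨fun n => e.symm (hσ.realCls (r n)), ⟨?_, ?_, fun n => ?_⟩, fun n m => ?_⟩
  · rw [e.symm_apply_eq, he_one, hr.zero_eq_one hσ, hσ.powBasis_apply, pow_zero, hσ.realCls_apply,
      Polynomial.map_one]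
  · rw [e.symm_apply_eq, hΘ.realCls_one_eq hξ hr, ← he_one, ← he_X, mul_one, ← he_smul, ← he_smul,
      ← map_add, C_ofReal_mul, ← C_ofReal_mul Θ.β 1, mul_one]
  · rw [Θ.sum_row_eq, sub_eq_zero, ← e.injective.eq_iff, he_X]
    simp_rw [map_sum, he_smul, e.apply_symm_apply]
    rw [hΘ.sum_J₅_smul hξ hr, ← hΘ.sum_J₃_smul, map_sum]
  · rw [(represents_iff hσ).1 hS, ← he, ← he, e.apply_symm_apply, e.apply_symm_apply]
    exact (orthonormal_iff_ite.1 (hr.orthonormal_realCls hσ) m n).trans (if_congr eq_comm rfl rfl)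

end Reconstruction

/-! ### From a pencil to a model -/

section Model

variable {Θ : Pencil} {p : ℕ → ℂ[X]}

theorem Pencil.IsAssociated.sum_J₅_smul (hp : Θ.IsAssociated p) (n : ℕ) :
    ∑ m ∈ Finset.range (n + 3), Θ.J₅ n m • p m =
      X * ∑ m ∈ Finset.range (n + 2), Θ.J₃ n m • p m :=
  sub_eq_zero.1 (Θ.sum_row_eq p n ▸ hp.row n)

theorem Pencil.J₃_superdiagonal_pos (Θ : Pencil) (n : ℕ) : 0 < Θ.J₃ n (n + 1) :=
  Θ.J₃_symm.apply n (n + 1) ▸ Θ.J₃_pos n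

theorem Pencil.IsAssociated.hasPosLeadingTerm (hp : Θ.IsAssociated p) (n : ℕ) :
    HasPosLeadingTerm ℝ (basisMonomials ℂ) n (p n) := by
  have hone : HasPosLeadingTerm ℝ (basisMonomials ℂ) 0 (1 : ℂ[X]) := by
    simpa using HasPosLeadingTerm.self (R := ℝ) (basisMonomials ℂ) 0
  induction n using Nat.strong_induction_on with
  | _ n ih =>
  match n, ih with
  | 0, _ => rwa [hp.zero]
  | 1, _ =>
    have hconst : C (Θ.β : ℂ) = Θ.β • (1 : ℂ[X]) := by rw [← C_ofReal_mul, mul_one]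
    rw [hp.one, C_ofReal_mul, hconst, ← mul_one (X : ℂ[X])]
    exact ((hasPosLeadingTerm_X_mul hone).smul Θ.α_pos).add_mem
      (Submodule.smul_mem _ _ (hone.mem_initialSpan one_pos))
  | n + 2, ih =>
    have hJ₅ : 0 < Θ.J₅ n (n + 2) := Θ.J₅_symm.apply n (n + 2) ▸ Θ.J₅_pos n
    have hrow : Θ.J₅ n (n + 2) • p (n + 2) = X * ∑ m ∈ Finset.range (n + 2), Θ.J₃ n m • p m -
        ∑ m ∈ Finset.range (n + 2), Θ.J₅ n m • p m := by
      rw [← hp.sum_J₅_smul, Finset.sum_range_succ, add_sub_cancel_left]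
    have hsum : HasPosLeadingTerm ℝ (basisMonomials ℂ) (n + 1)
        (∑ m ∈ Finset.range (n + 2), Θ.J₃ n m • p m) :=
      .sum (fun m hm => ih m (by omega)) (Θ.J₃_superdiagonal_pos n)
    refine .of_smul hJ₅ ?_
    rw [hrow, sub_eq_add_neg]
    refine (hasPosLeadingTerm_X_mul hsum).add_mem (neg_mem (sum_mem fun m hm => ?_))
    exact Submodule.smul_mem _ _
      ((ih m (Finset.mem_range.1 hm)).mem_initialSpan (Finset.mem_range.1 hm))

/-- For the orthonormal polynomials `r` of a measure, the correspondence `p n ↦ r n`. -/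
def Pencil.IsAssociated.modelEquiv (hp : Θ.IsAssociated p) {σ : Measure ℝ} (hσ : Admissible σ)
    {r : ℕ → ℝ[X]} (hr : IsOrthonormalSystem σ r) : ℂ[X] ≃ₗ[ℂ] hσ.polys :=
  (triangularBasis hp.hasPosLeadingTerm).equiv
    (triangularBasis (hr.hasPosLeadingTerm_realCls hσ)) (Equiv.refl ℕ)

/-- Multiplication by the variable, transported to the classes of polynomials along `p n ↦ r n`. -/
def Pencil.IsAssociated.modelOperator (hp : Θ.IsAssociated p) {σ : Measure ℝ} (hσ : Admissible σ)
    {r : ℕ → ℝ[X]} (hr : IsOrthonormalSystem σ r) : Module.End ℂ hσ.polys :=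
  (hp.modelEquiv hσ hr).conj (LinearMap.mulLeft ℂ X)

variable {σ : Measure ℝ} {hσ : Admissible σ} {r : ℕ → ℝ[X]}

theorem Pencil.IsAssociated.modelEquiv_apply (hp : Θ.IsAssociated p)
    (hr : IsOrthonormalSystem σ r) (n : ℕ) : hp.modelEquiv hσ hr (p n) = hσ.realCls (r n) := by
  have h := (triangularBasis hp.hasPosLeadingTerm).equiv_apply n
    (triangularBasis (hr.hasPosLeadingTerm_realCls hσ)) (Equiv.refl ℕ)
  rwa [coe_triangularBasis, coe_triangularBasis] at h

theorem Pencil.IsAssociated.modelEquiv_one (hp : Θ.IsAssociated p)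
    (hr : IsOrthonormalSystem σ r) : hp.modelEquiv hσ hr 1 = hσ.powBasis 0 := by
  rw [← hp.zero, hp.modelEquiv_apply, hr.zero_eq_one hσ, hσ.powBasis_apply, pow_zero,
    hσ.realCls_apply, Polynomial.map_one]

theorem Pencil.IsAssociated.modelOperator_modelEquiv (hp : Θ.IsAssociated p)
    (hr : IsOrthonormalSystem σ r) (u : ℂ[X]) :
    hp.modelOperator hσ hr (hp.modelEquiv hσ hr u) = hp.modelEquiv hσ hr (X * u) := by
  rw [modelOperator, LinearEquiv.conj_apply_apply, LinearEquiv.symm_apply_apply,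
    LinearMap.mulLeft_apply]

theorem Pencil.IsAssociated.modelEquiv_sum_smul (hp : Θ.IsAssociated p)
    (hr : IsOrthonormalSystem σ r) (c : ℕ → ℝ) (s : Finset ℕ) :
    hp.modelEquiv hσ hr (∑ m ∈ s, c m • p m) = ∑ m ∈ s, c m • hσ.realCls (r m) := by
  rw [map_sum]
  refine Finset.sum_congr rfl fun m _ => ?_
  rw [← hp.modelEquiv_apply hr]
  exact (hp.modelEquiv hσ hr).toLinearMap.map_smul_of_tower (c m) (p m)

theorem Pencil.IsAssociated.represents (hp : Θ.IsAssociated p) (hr : IsOrthonormalSystem σ r)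
    {S : ℂ[X] →ₗ[ℂ] ℂ[X] →ₗ⋆[ℂ] ℂ} (hS : ∀ n m, S (p n) (p m) = if n = m then 1 else 0) :
    Represents hσ (hp.modelOperator hσ hr) S := by
  set e := hp.modelEquiv hσ hr with he
  let b := triangularBasis hp.hasPosLeadingTerm
  have hb : ⇑b = p := coe_triangularBasis _
  have hform : S = ((innerₛₗ ℂ).comp e.toLinearMap).flip.comp e.toLinearMap := by
    refine LinearMap.ext_basis b b fun n m => ?_
    change S (b n) (b m) = inner ℂ (e (b m)) (e (b n))
    rw [hb, hS, he, hp.modelEquiv_apply, hp.modelEquiv_apply]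
    exact ((orthonormal_iff_ite.1 (hr.orthonormal_realCls hσ) m n).trans
      (if_congr eq_comm rfl rfl)).symm
  refine (represents_iff hσ).2 fun u v => ?_
  rw [← hp.modelEquiv_one hr, modelOperator, ← he, aeval_conj_mulLeft_X, aeval_conj_mulLeft_X,
    hform]
  rfl

theorem Pencil.IsAssociated.hasPosLeadingTerm_modelOperator (hp : Θ.IsAssociated p)
    (hr : IsOrthonormalSystem σ r) (n : ℕ) :
    HasPosLeadingTerm ℝ hσ.powBasis (n + 1) (hp.modelOperator hσ hr (hσ.powBasis n)) := by
  refine .basis_change (fun k => ?_) (HasPosLeadingTerm.symm (hr.hasPosLeadingTerm_realCls hσ)) n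
  have hX : HasPosLeadingTerm ℝ p (k + 1) (X * p k) :=
    .trans (d := 0) (HasPosLeadingTerm.symm hp.hasPosLeadingTerm)
      (hasPosLeadingTerm_X_mul (hp.hasPosLeadingTerm k))
  have hcomp : (hp.modelEquiv hσ hr).toLinearMap.restrictScalars ℝ ∘ p = hσ.realCls ∘ r :=
    funext (hp.modelEquiv_apply hr)
  have hmap := hX.map ((hp.modelEquiv hσ hr).toLinearMap.restrictScalars ℝ)
  rw [hcomp, LinearMap.restrictScalars_apply, LinearEquiv.coe_coe] at hmap
  rwa [Function.comp_apply, ← hp.modelEquiv_apply hr, hp.modelOperator_modelEquiv]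

theorem Pencil.IsAssociated.modelOperator_mulX_isSymmetric (hp : Θ.IsAssociated p)
    (hr : IsOrthonormalSystem σ r)
    (hrec : ∀ n, ∑ m ∈ Finset.range (n + 2), Θ.J₃ n m • r m = X * r n) :
    (hp.modelOperator hσ hr ∘ₗ hσ.mulX).IsSymmetric := by
  let b := triangularBasis (hr.hasPosLeadingTerm_realCls hσ)
  have hb : ⇑b = hσ.realCls ∘ r := coe_triangularBasis _
  have horth : Orthonormal ℂ (LinearMap.id (R := ℂ) ∘ b) := hb ▸ hr.orthonormal_realCls hσ
  have hT (n : ℕ) : (hp.modelOperator hσ hr ∘ₗ hσ.mulX) (b n) =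
      ∑ m ∈ Finset.range (n + 3), Θ.J₅ n m • b m := by
    simp_rw [hb, Function.comp_apply]
    rw [LinearMap.comp_apply, ← hσ.realCls_X_mul, ← hrec, map_sum]
    simp_rw [map_smul]
    rw [← hp.modelEquiv_sum_smul hr, hp.modelOperator_modelEquiv, ← hp.sum_J₅_smul,
      hp.modelEquiv_sum_smul]
  exact fun x y => inner_map_symm_of_isSymm_matrix horth Θ.J₅_symm Θ.J₅_fiveDiagonal hT x y

theorem Pencil.IsSpectralFunction.exists_model {S : ℂ[X] →ₗ[ℂ] ℂ[X] →ₗ⋆[ℂ] ℂ}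
    (hS : Θ.IsSpectralFunction S) :
    ∃ (σ : Measure ℝ) (hσ : Admissible σ) (𝒜 : Module.End ℂ hσ.polys),
      IsModelOperator hσ 𝒜 ∧ Represents hσ 𝒜 S := by
  obtain ⟨p, hp, hSp⟩ := hS
  obtain ⟨σ, hσ, hr⟩ := favard_exists_isOrthonormalSystem Θ.J₃_symm Θ.J₃_tridiagonal
    Θ.J₃_superdiagonal_pos
  exact ⟨σ, hσ, hp.modelOperator hσ hr,
    ⟨(exists_isExpansion_iff hσ).2 (hp.hasPosLeadingTerm_modelOperator hr),
      hp.modelOperator_mulX_isSymmetric hr (sum_smul_recurrencePoly Θ.J₃_superdiagonal_pos)⟩,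
    hp.represents hr hSp⟩

end Model

end JacobiPencil

end

open MeasureTheory Polynomial ComplexConjugate JacobiPencil in
theorem theorem3p1 (S : ℂ[X] →ₗ[ℂ] ℂ[X] →ₗ⋆[ℂ] ℂ)
    (hS_herm : ∀ u v : ℂ[X], conj (S u v) = S v u)
    (hS_nonneg : ∀ u : ℂ[X], 0 ≤ (S u u).re) :
    ((∃ Θ : Pencil, Θ.IsSpectralFunction S) ↔
      ∃ (σ : Measure ℝ) (hσ : Admissible σ) (𝒜 : Module.End ℂ hσ.polys),
        IsModelOperator hσ 𝒜 ∧ Represents hσ 𝒜 S) ∧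
    (∀ (σ : Measure ℝ) (hσ : Admissible σ) (𝒜 : Module.End ℂ hσ.polys),
      IsModelOperator hσ 𝒜 → Represents hσ 𝒜 S →
        ∃ (ξ : ℕ → ℕ → ℝ) (r : ℕ → ℝ[X]) (Θ : Pencil),
          IsExpansion hσ 𝒜 ξ ∧ IsOrthonormalSystem σ r ∧ IsReconstructed hσ 𝒜 ξ r Θ ∧
            Θ.IsSpectralFunction S) := by
  have hpencil (σ : Measure ℝ) (hσ : Admissible σ) (𝒜 : Module.End ℂ hσ.polys)
      (h𝒜 : IsModelOperator hσ 𝒜) (hS : Represents hσ 𝒜 S) :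
      ∃ (ξ : ℕ → ℕ → ℝ) (r : ℕ → ℝ[X]) (Θ : Pencil), IsExpansion hσ 𝒜 ξ ∧
        IsOrthonormalSystem σ r ∧ IsReconstructed hσ 𝒜 ξ r Θ ∧ Θ.IsSpectralFunction S := by
    obtain ⟨ξ, hξ⟩ := h𝒜.expansion
    obtain ⟨r, hr⟩ := exists_isOrthonormalSystem hσ
    obtain ⟨Θ, hΘ⟩ := exists_isReconstructed h𝒜.symmetric hξ hr
    exact ⟨ξ, r, Θ, hξ, hr, hΘ, hΘ.isSpectralFunction hξ hr hS⟩
  refine ⟨⟨fun ⟨Θ, hΘ⟩ => hΘ.exists_model, fun ⟨σ, hσ, 𝒜, h𝒜, hS⟩ => ?_⟩, hpencil⟩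
  obtain ⟨_, _, Θ, _, _, _, hΘ⟩ := hpencil σ hσ 𝒜 h𝒜 hS
  exact ⟨Θ, hΘ⟩
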